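/- A subtree of a finite tree $T$ is a nonempty induced subgraph of $T$ that is connected (hence again a tree). The mean subtree order $\mu_T$ is the average number of vertices of a subtree of $T$, averaged over all subtrees of $T$. A tree with $n$ vertices is called optimal if it has the greatest mean subtree order among all trees with $n$ vertices. For every positive integer $n$, let $\hat{T}_n$ be an optimal tree with $n$ vertices, and let $\operatorname{diam}(\hat{T}_n)$ denote its diameter (the greatest distance between two of its vertices, i.e. the number of edges of a longest path). Then, for every $\delta > 0$, $$\lim_{n \to \infty} \frac{n - \operatorname{diam}(\hat{T}_n)}{n^{1/2+\delta}} = 0.$$ -/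

import Mathlib

open Filter Topology

namespace SimpleGraph

variable {V : Type*} [Fintype V]

open Classical in
/-- The subtrees of a tree `G`, each given by its set of vertices: the vertex sets that induce a
connected subgraph. `SimpleGraph.Connected` includes that the vertex set is nonempty. -/
noncomputable def subtreeSets (G : SimpleGraph V) : Finset (Finset V) :=
  Finset.univ.filter fun S => (G.induce (S : Set V)).Connected

/-- The mean subtree order of `G`: the average number of vertices of its subtrees. -/
noncomputable def meanSubtreeOrder (G : SimpleGraph V) : ℝ :=
  (∑ S ∈ G.subtreeSets, (S.card : ℝ)) / (G.subtreeSets.card : ℝ)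

/-- `G` is an optimal tree: a tree whose mean subtree order is the greatest possible among all
trees with the same number of vertices (up to isomorphism, these all live on `V`). -/
def IsOptimalTree (G : SimpleGraph V) : Prop :=
  G.IsTree ∧ ∀ H : SimpleGraph V, H.IsTree → H.meanSubtreeOrder ≤ G.meanSubtreeOrder

end SimpleGraph

/-! Call the number of vertices missed by a subtree its loss; the mean loss of a tree on `n`
vertices is `n` minus its mean subtree order. Two opposite estimates on the mean loss force an
optimal tree to be close to a path.

Upper bound: a double broom with about `2 log₂ n` leaves at either end has mean loss at most `2 log₂
n + O(1)`, because most of its subtrees contain the whole path and choose leaves freely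
(`card_sub_meanSubtreeOrder_doubleBroom_le`). An optimal tree does at least as well; let `B` bound
its mean loss.

Lower bound: every leaf is missed by almost half of all subtrees, so there are `O(B)` leaves. Hence,
if `n - diam` is large, some leg of length `c ≳ (n - diam) / B` hangs off a longest path at a vertex
`v` that cuts this path into legs of lengths `a, b ≥ c` (`exists_three_paths`). Nearly all subtrees
contain `v`, since avoiding `v` costs at least `c` vertices. Small loss forces the traces on a leg's
branch to be numerous: a leg of length `l` yields at least `l² / (16B)` of them (`sq_mul_card_le`).
Traces on different branches combine freely, so about `(abc)²` subtrees, up to powers of `B`, pass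
through `v`. An entropy inequality says that `M` subtrees through `v` have mean loss at least `log₂
M / 2` (`card_mul_logb_card_le`).

Together, `2 log₂ (abc) ≤ 4 log₂ n + O(log log n)`. Since `ab ≥ c · diam / 2`, the product `abc` is
of order at least `(n - diam)² n` up to logarithms. So `n - diam` exceeds `n^(1/2)` by at most
subpolynomial factors. -/

namespace SimpleGraph

/-! ### Connected vertex sets in trees. -/

section Subtrees

variable {V : Type*} {G : SimpleGraph V}

/-- The vertex set `S` induces a connected subgraph. -/
def ConnectedOn (G : SimpleGraph V) (S : Finset V) : Prop :=
  (G.induce (S : Set V)).Connected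

theorem ConnectedOn.nonempty {S : Finset V} (h : G.ConnectedOn S) : S.Nonempty := by
  obtain ⟨x⟩ : Nonempty (S : Set V) := Connected.nonempty h
  exact ⟨x.1, x.2⟩

theorem mem_subtreeSets [Fintype V] {S : Finset V} : S ∈ G.subtreeSets ↔ G.ConnectedOn S := by
  simp [subtreeSets, ConnectedOn]

theorem connectedOn_singleton (v : V) : G.ConnectedOn {v} := by
  have : Nonempty ((({v} : Finset V) : Set V)) := ⟨⟨v, by simp⟩⟩
  refine ⟨fun a b => ?_⟩
  have : a = b := by
    have ha := a.2
    have hb := b.2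
    simp only [Finset.coe_singleton, Set.mem_singleton_iff] at ha hb
    exact Subtype.ext (ha.trans hb.symm)
  rw [this]

theorem connectedOn_univ [Fintype V] (h : G.Connected) : G.ConnectedOn Finset.univ := by
  unfold ConnectedOn
  rw [Finset.coe_univ]
  exact (Iso.connected_iff (induceUnivIso G)).2 h

/-- A set in which every point is joined to a base point by a connected subset is connected. -/
theorem connectedOn_of_forall_exists {S : Finset V} {v : V} (hv : v ∈ S)
    (h : ∀ z ∈ S, ∃ R ⊆ S, G.ConnectedOn R ∧ v ∈ R ∧ z ∈ R) : G.ConnectedOn S := by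
  refine induce_connected_of_patches v hv fun {z} hz => ?_
  obtain ⟨R, hRS, hR, hvR, hzR⟩ := h z hz
  exact ⟨R, by exact_mod_cast hRS, hvR, hzR, hR.preconnected _ _⟩

theorem ConnectedOn.exists_adj_of_mem_of_notMem {S : Finset V} (h : G.ConnectedOn S)
    (A : Set V) {x y : V} (hx : x ∈ S) (hy : y ∈ S) (hxA : x ∈ A) (hyA : y ∉ A) :
    ∃ a ∈ S, ∃ b ∈ S, a ∈ A ∧ b ∉ A ∧ G.Adj a b := by
  obtain ⟨p⟩ := h.preconnected ⟨x, hx⟩ ⟨y, hy⟩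
  obtain ⟨d, -, h1, h2⟩ := p.exists_boundary_dart (Subtype.val ⁻¹' A) hxA hyA
  exact ⟨d.fst.1, d.fst.2, d.snd.1, d.snd.2, h1, h2, d.adj⟩

variable [DecidableEq V]

theorem ConnectedOn.union {S T : Finset V} (hS : G.ConnectedOn S) (hT : G.ConnectedOn T)
    (h : (S ∩ T).Nonempty) : G.ConnectedOn (S ∪ T) := by
  unfold ConnectedOn
  rw [Finset.coe_union]
  exact induce_union_connected hS.preconnected hT.preconnected (by exact_mod_cast h)

theorem ConnectedOn.union_of_mem {S T : Finset V} {v : V} (hS : G.ConnectedOn S)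
    (hT : G.ConnectedOn T) (h : v ∈ S) (h' : v ∈ T) : G.ConnectedOn (S ∪ T) :=
  hS.union hT ⟨v, Finset.mem_inter.2 ⟨h, h'⟩⟩

theorem Walk.connectedOn_support {u v : V} (p : G.Walk u v) :
    G.ConnectedOn p.support.toFinset := by
  have := p.connected_induce_support
  unfold ConnectedOn
  rwa [List.coe_toFinset]

theorem ConnectedOn.insert {S : Finset V} {a b : V} (hS : G.ConnectedOn S) (ha : a ∈ S)
    (hab : G.Adj a b) : G.ConnectedOn (insert b S) := by
  have h2 := hab.toWalk.connectedOn_support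
  have := hS.union_of_mem h2 ha (by simp)
  convert this using 1
  ext z
  simp
  grind

/-- A path in a tree lies in every connected set that contains its ends. -/
theorem IsAcyclic.support_subset (hG : G.IsAcyclic) {S : Finset V} (hS : G.ConnectedOn S)
    {u w : V} {p : G.Walk u w} (hp : p.IsPath) (hu : u ∈ S) (hw : w ∈ S) :
    ∀ z ∈ p.support, z ∈ S := by
  obtain ⟨q⟩ := hS.preconnected ⟨u, hu⟩ ⟨w, hw⟩
  let q' : G.Walk u w := q.map (Embedding.induce (G := G) (S : Set V)).toHom
  have e : p = q'.bypass := by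
    have := (hG.subsingleton_path u w).elim ⟨p, hp⟩ ⟨q'.bypass, q'.bypass_isPath⟩
    exact congrArg Subtype.val this
  intro z hz
  rw [e] at hz
  have : z ∈ (q.map (Embedding.induce (G := G) (S : Set V)).toHom).support :=
    q'.support_bypass_subset_support hz
  rw [Walk.support_map] at this
  obtain ⟨a, -, rfl⟩ := List.mem_map.1 this
  exact a.2

theorem IsTree.connectedOn_inter (hG : G.IsTree) {S T : Finset V} (hS : G.ConnectedOn S)
    (hT : G.ConnectedOn T) {v : V} (h : v ∈ S) (h' : v ∈ T) : G.ConnectedOn (S ∩ T) := by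
  refine connectedOn_of_forall_exists (Finset.mem_inter.2 ⟨h, h'⟩) fun z hz => ?_
  obtain ⟨hz, hz'⟩ := Finset.mem_inter.1 hz
  obtain ⟨p, hp, -⟩ := hG.existsUnique_path v z
  refine ⟨p.support.toFinset, fun x hx => ?_, p.connectedOn_support, by simp, by simp⟩
  rw [List.mem_toFinset] at hx
  exact Finset.mem_inter.2 ⟨hG.isAcyclic.support_subset hS hp h hz x hx,
    hG.isAcyclic.support_subset hT hp h' hz' x hx⟩

/-- Grow `K` inside `W` by one adjacent vertex at a time; the last vertex added can be removed
again. -/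
theorem ConnectedOn.exists_erase {K W : Finset V} (hK : G.ConnectedOn K) (hW : G.ConnectedOn W)
    (hKW : K ⊂ W) : ∃ x ∈ W, x ∉ K ∧ G.ConnectedOn (W.erase x) := by
  induction hn : (W \ K).card using Nat.strong_induction_on generalizing K with
  | _ n ih =>
    obtain ⟨x, hxW, hxK⟩ := Finset.exists_of_ssubset hKW
    obtain ⟨k, hk⟩ := hK.nonempty
    obtain ⟨a, -, b, hb, ha, hbK, hab⟩ :=
      hW.exists_adj_of_mem_of_notMem (K : Set V) (hKW.1 hk) hxW (by simpa using hk)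
        (by simpa using hxK)
    simp only [Finset.mem_coe] at ha hbK
    have hK' := hK.insert ha hab
    have hsub : Insert.insert b K ⊆ W := Finset.insert_subset hb hKW.1
    rcases hsub.eq_or_ssubset with h | h
    · refine ⟨b, hb, hbK, ?_⟩
      rw [← h, Finset.erase_insert hbK]
      exact hK
    · obtain ⟨y, hy, hyK, hc⟩ := ih _ (by
        rw [← hn]
        refine Finset.card_lt_card ⟨fun z => by grind, fun h' => ?_⟩
        have := h' (Finset.mem_sdiff.2 ⟨hb, hbK⟩)
        simp at this) hK' h rfl
      exact ⟨y, hy, fun h => hyK (Finset.mem_insert_of_mem h), hc⟩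

/-- A vertex outside a connected set of a tree has at most one neighbour in it. -/
theorem IsAcyclic.eq_of_adj_of_adj (hG : G.IsAcyclic) {S : Finset V} (hS : G.ConnectedOn S)
    {v a b : V} (hv : v ∉ S) (ha : a ∈ S) (hb : b ∈ S) (hva : G.Adj v a) (hvb : G.Adj v b) :
    a = b := by
  by_contra hne
  have hp : (Walk.cons hva.symm (Walk.cons hvb Walk.nil)).IsPath := by
    simp [Walk.cons_isPath_iff, hvb.ne, hva.ne.symm, hne]
  exact hv (hG.support_subset hS hp ha hb v (by simp))

open Classical in
/-- The vertices that can be joined to `v` by a connected set avoiding `x`. -/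
noncomputable def sideOf [Fintype V] (G : SimpleGraph V) (v x : V) : Finset V :=
  Finset.univ.filter fun z => ∃ S, G.ConnectedOn S ∧ v ∈ S ∧ z ∈ S ∧ x ∉ S

theorem mem_sideOf [Fintype V] {v x z : V} :
    z ∈ G.sideOf v x ↔ ∃ S, G.ConnectedOn S ∧ v ∈ S ∧ z ∈ S ∧ x ∉ S := by
  simp [sideOf]

theorem notMem_sideOf [Fintype V] (v x : V) : x ∉ G.sideOf v x := by
  rw [mem_sideOf]
  rintro ⟨S, -, -, h, h'⟩
  exact h' h

theorem self_mem_sideOf [Fintype V] {v x : V} (h : v ≠ x) : v ∈ G.sideOf v x :=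
  mem_sideOf.2 ⟨{v}, connectedOn_singleton v, by simp, by simp, by simpa using h.symm⟩

theorem connectedOn_sideOf [Fintype V] {v x : V} (h : v ≠ x) : G.ConnectedOn (G.sideOf v x) := by
  refine connectedOn_of_forall_exists (self_mem_sideOf h) fun z hz => ?_
  obtain ⟨S, hS, hv, hz, hx⟩ := mem_sideOf.1 hz
  exact ⟨S, fun y hy => mem_sideOf.2 ⟨S, hS, hv, hy, hx⟩, hS, hv, hz⟩

/-- The parts of a tree that are cut off from `v` by distinct neighbours of `v` are disjoint. -/
theorem IsTree.mem_sideOf_or_mem_sideOf [Fintype V] (hG : G.IsTree) {v a b : V} (hva : G.Adj v a)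
    (hvb : G.Adj v b) (hab : a ≠ b) (z : V) : z ∈ G.sideOf v a ∨ z ∈ G.sideOf v b := by
  obtain ⟨p, hp, -⟩ := hG.existsUnique_path v z
  have key : ∀ c, G.Adj v c → z ∉ G.sideOf v c → p.snd = c := by
    intro c hvc hz
    cases p with
    | nil => exact absurd (self_mem_sideOf hvc.ne) hz
    | @cons _ w _ h q =>
      rw [Walk.cons_isPath_iff] at hp
      rw [Walk.snd_cons]
      have hcz : c ∈ (Walk.cons h q).support := by
        by_contra hc
        exact hz (mem_sideOf.2 ⟨_, (Walk.cons h q).connectedOn_support, by simp, by simp,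
          by simpa using hc⟩)
      rw [Walk.support_cons, List.mem_cons] at hcz
      have hcq := hcz.resolve_left hvc.ne.symm
      exact hG.isAcyclic.eq_of_adj_of_adj q.connectedOn_support (v := v) (by simpa using hp.2)
        (by simp) (by simpa using hcq) h hvc
  by_contra! hne
  exact hab ((key a hva hne.1).symm.trans (key b hvb hne.2))

end Subtrees

end SimpleGraph

/-! ### An entropy inequality for families closed under intersection. -/

/-- Midpoint convexity of `x log x` gives the bound with `A + B` in place of `2 * A`. The weaker
form is the induction step for merging two classes of sizes `A ≥ B`. -/
theorem add_mul_logb_two_le {A B : ℝ} (hB : 0 < B) (hBA : B ≤ A) :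
    (A + B) * Real.logb 2 (A + B) ≤ A * Real.logb 2 A + B * Real.logb 2 B + 2 * A := by
  have hA : 0 < A := hB.trans_le hBA
  have h2 : 0 < Real.log 2 := Real.log_pos one_lt_two
  have key := Real.convexOn_mul_log.2 (Set.mem_Ici.2 hA.le) (Set.mem_Ici.2 hB.le)
    (by norm_num : (0 : ℝ) ≤ 1 / 2) (by norm_num : (0 : ℝ) ≤ 1 / 2) (by norm_num)
  simp only [smul_eq_mul] at key
  rw [show 1 / 2 * A + 1 / 2 * B = (A + B) / 2 by ring,
    Real.log_div (by positivity) two_ne_zero] at key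
  have h3 : B * Real.log 2 ≤ A * Real.log 2 := mul_le_mul_of_nonneg_right hBA h2.le
  have e : ∀ x, x * Real.logb 2 x = x * Real.log x / Real.log 2 := fun x => by
    rw [Real.logb, mul_div_assoc]
  rw [e, e, e, ← add_div, ← sub_le_iff_le_add', ← sub_div, div_le_iff₀ h2]
  nlinarith

/-- In a family of finite sets that is closed under intersections and in which any member can be
shrunk to any smaller member one point at a time, the `m` members of an interval `[K, W]` miss on
average at least `logb 2 m / 2` points of `W`. -/
theorem card_mul_logb_card_le {V : Type*} [DecidableEq V] {F : Finset (Finset V)}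
    (hinter : ∀ S ∈ F, ∀ T ∈ F, S ∩ T ∈ F)
    (herase : ∀ K ∈ F, ∀ W ∈ F, K ⊂ W → ∃ x ∈ W, x ∉ K ∧ W.erase x ∈ F)
    {K W : Finset V} (hK : K ∈ F) (hW : W ∈ F) (hKW : K ⊆ W) :
    ((F.filter fun S => K ⊆ S ∧ S ⊆ W).card : ℝ) *
        Real.logb 2 (F.filter fun S => K ⊆ S ∧ S ⊆ W).card ≤
      2 * ∑ S ∈ F.filter (fun S => K ⊆ S ∧ S ⊆ W), ((W \ S).card : ℝ) := by
  induction hn : (W \ K).card using Nat.strong_induction_on generalizing K W with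
  | _ n ih =>
  rcases hKW.eq_or_ssubset with rfl | hss
  · have : (F.filter fun S => K ⊆ S ∧ S ⊆ K) = {K} := by
      ext S
      simp only [Finset.mem_filter, Finset.mem_singleton]
      refine ⟨fun h => h.2.2.antisymm h.2.1, ?_⟩
      rintro rfl
      exact ⟨hK, subset_rfl, subset_rfl⟩
    simp [this]
  -- The interval splits according to membership of `x`. Closure under intersection gives a least
  -- member `K'` containing `x`, so both classes are intervals again.
  obtain ⟨x, hxW, hxK, hWx⟩ := herase K hK W hW hss
  obtain ⟨K', hK', hmin⟩ := (F.filter fun S => K ⊆ S ∧ S ⊆ W ∧ x ∈ S).exists_min_image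
    Finset.card ⟨W, by simp [hW, hKW, hxW]⟩
  simp only [Finset.mem_filter] at hK' hmin
  obtain ⟨hK'F, hKK', hK'W, hxK'⟩ := hK'
  have hleast : ∀ S ∈ F, K ⊆ S → S ⊆ W → x ∈ S → K' ⊆ S := fun S hS h1 h2 h3 => by
    have := hmin (K' ∩ S) ⟨hinter _ hK'F _ hS, Finset.subset_inter hKK' h1,
      Finset.inter_subset_left.trans hK'W, Finset.mem_inter.2 ⟨hxK', h3⟩⟩
    exact Finset.inter_eq_left.1 (Finset.eq_of_subset_of_card_le Finset.inter_subset_left this)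
  set A := F.filter fun S => K ⊆ S ∧ S ⊆ W.erase x
  set B := F.filter fun S => K' ⊆ S ∧ S ⊆ W
  have hAB : (F.filter fun S => K ⊆ S ∧ S ⊆ W) = A ∪ B := by
    ext S
    simp only [A, B, Finset.mem_filter, Finset.mem_union]
    constructor
    · rintro ⟨hS, h1, h2⟩
      by_cases hx : x ∈ S
      · exact Or.inr ⟨hS, hleast S hS h1 h2 hx, h2⟩
      · exact Or.inl ⟨hS, h1, fun y hy => Finset.mem_erase.2 ⟨fun h => hx (h ▸ hy), h2 hy⟩⟩
    · rintro (⟨hS, h1, h2⟩ | ⟨hS, h1, h2⟩)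
      · exact ⟨hS, h1, h2.trans (Finset.erase_subset _ _)⟩
      · exact ⟨hS, hKK'.trans h1, h2⟩
  have hxB : ∀ S ∈ B, x ∈ S := fun S hS => (Finset.mem_filter.1 hS).2.1 hxK'
  have hxA : ∀ S ∈ A, x ∉ S := fun S hS h => by
    simpa using (Finset.mem_filter.1 hS).2.2 h
  have hdisj : Disjoint A B := Finset.disjoint_left.2 fun S hA hB => hxA S hA (hxB S hB)
  have hcard : B.card ≤ A.card := by
    refine Finset.card_le_card_of_injOn (fun S => S.erase x) (fun S hS => ?_) fun S hS T hT h => ?_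
    · have hS' := Finset.mem_filter.1 hS
      refine Finset.mem_filter.2 ⟨?_, ?_, Finset.erase_subset_erase _ hS'.2.2⟩
      · have : S.erase x = S ∩ W.erase x := by
          ext y
          have := @hS'.2.2 y
          simp only [Finset.mem_erase, Finset.mem_inter]
          tauto
        simp only [this]
        exact hinter _ hS'.1 _ hWx
      · exact fun y hy => Finset.mem_erase.2 ⟨fun h => hxK (h ▸ hy), hS'.2.1 (hKK' hy)⟩
    · simp only at h
      rw [← Finset.insert_erase (hxB S hS), h, Finset.insert_erase (hxB T hT)]
  have hBpos : 0 < B.card := Finset.card_pos.2 ⟨W, by simp [B, hW, hK'W]⟩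
  have ihA := ih _ (by
    rw [← hn]
    refine Finset.card_lt_card ⟨fun y => by simp; tauto, fun h => ?_⟩
    simpa using h (Finset.mem_sdiff.2 ⟨hxW, hxK⟩)) hK hWx
    (fun y hy => Finset.mem_erase.2 ⟨fun h => hxK (h ▸ hy), hKW hy⟩) rfl
  have ihB := ih _ (by
    rw [← hn]
    refine Finset.card_lt_card ⟨fun y => ?_, fun h => ?_⟩
    · have := @hKK' y
      simp only [Finset.mem_sdiff]
      tauto
    · simpa [hxK'] using h (Finset.mem_sdiff.2 ⟨hxW, hxK⟩)) hK'F hW hK'W rfl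
  rw [hAB, Finset.card_union_of_disjoint hdisj, Finset.sum_union hdisj]
  -- Each member of the larger class `A` also misses `x`; this extra loss pays for the term `2 * A`
  -- of the convexity bound.
  have hsum : ∑ S ∈ A, ((W \ S).card : ℝ) = ∑ S ∈ A, ((W.erase x \ S).card : ℝ) + A.card := by
    rw [Finset.cast_card, ← Finset.sum_add_distrib]
    refine Finset.sum_congr rfl fun S hS => ?_
    have : W \ S = insert x (W.erase x \ S) := by
      ext y
      have := hxA S hS
      by_cases h : y = x
      · subst h; simp [hxW, this]
      · simp [h]
    rw [this, Finset.card_insert_of_notMem (by simp)]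
    push_cast
    ring
  have := add_mul_logb_two_le (A := A.card) (B := B.card) (by exact_mod_cast hBpos)
    (by exact_mod_cast hcard)
  rw [hsum]
  push_cast
  linarith

namespace SimpleGraph

/-! ### Subtrees through a vertex and their traces on its branches. -/

section Legs

variable {V : Type*} [Fintype V] [DecidableEq V] {G : SimpleGraph V}

open Classical in
/-- The subtrees of `G` that contain `v`. -/
noncomputable def subtreeSetsAt (G : SimpleGraph V) (v : V) : Finset (Finset V) :=
  G.subtreeSets.filter (v ∈ ·)

theorem mem_subtreeSetsAt {v : V} {S : Finset V} :
    S ∈ G.subtreeSetsAt v ↔ G.ConnectedOn S ∧ v ∈ S := by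
  classical
  rw [subtreeSetsAt, Finset.mem_filter, mem_subtreeSets]

/-- The total number of vertices missed by the members of a family of vertex sets. -/
def totalLoss (F : Finset (Finset V)) : ℝ := ∑ S ∈ F, (Sᶜ.card : ℝ)

theorem totalLoss_nonneg (F : Finset (Finset V)) : 0 ≤ totalLoss F :=
  Finset.sum_nonneg fun _ _ => Nat.cast_nonneg _

theorem totalLoss_mono {F F' : Finset (Finset V)} (h : F ⊆ F') : totalLoss F ≤ totalLoss F' :=
  Finset.sum_le_sum_of_subset_of_nonneg h fun _ _ _ => Nat.cast_nonneg _

theorem card_mul_le_totalLoss {F : Finset (Finset V)} {a : ℝ}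
    (h : ∀ S ∈ F, a ≤ Sᶜ.card) : F.card * a ≤ totalLoss F := by
  rw [← nsmul_eq_mul]
  exact Finset.card_nsmul_le_sum _ _ _ h

theorem IsTree.card_subtreeSetsAt_mul_logb_le (hG : G.IsTree) (v : V) :
    ((G.subtreeSetsAt v).card : ℝ) * Real.logb 2 (G.subtreeSetsAt v).card ≤
      2 * totalLoss (G.subtreeSetsAt v) := by
  have h := card_mul_logb_card_le (F := G.subtreeSetsAt v) (K := {v}) (W := Finset.univ)
    (fun S hS T hT => by
      rw [mem_subtreeSetsAt] at *
      exact ⟨hG.connectedOn_inter hS.1 hT.1 hS.2 hT.2, Finset.mem_inter.2 ⟨hS.2, hT.2⟩⟩)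
    (fun K hK W hW hKW => by
      rw [mem_subtreeSetsAt] at hK hW
      obtain ⟨x, hx, hxK, hc⟩ := hK.1.exists_erase hW.1 hKW
      exact ⟨x, hx, hxK, mem_subtreeSetsAt.2
        ⟨hc, Finset.mem_erase.2 ⟨fun h => hxK (h ▸ hK.2), hW.2⟩⟩⟩)
    (mem_subtreeSetsAt.2 ⟨connectedOn_singleton v, by simp⟩)
    (mem_subtreeSetsAt.2 ⟨connectedOn_univ hG.connected, by simp⟩) (Finset.subset_univ _)
  have e : (G.subtreeSetsAt v).filter (fun S => {v} ⊆ S ∧ S ⊆ Finset.univ) = G.subtreeSetsAt v :=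
    Finset.filter_true_of_mem fun S hS => by simpa using (mem_subtreeSetsAt.1 hS).2
  rw [e] at h
  simpa only [totalLoss, Finset.compl_eq_univ_sdiff] using h

omit [Fintype V] in
theorem IsTree.getVert_mem_of_getVert_mem (hG : G.IsTree) {v y : V} {w : G.Walk v y}
    (hw : w.IsPath) {S : Finset V} (hS : G.ConnectedOn S) (hv : v ∈ S) {i j : ℕ} (hij : i ≤ j)
    (hj : w.getVert j ∈ S) : w.getVert i ∈ S := by
  rcases le_total w.length i with h | h
  · rw [w.getVert_of_length_le (h.trans hij)] at hj
    rwa [w.getVert_of_length_le h]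
  · refine hG.isAcyclic.support_subset hS (hw.take j) hv hj _ ?_
    rw [Walk.mem_support_iff_exists_getVert]
    exact ⟨i, by simp [Walk.take_getVert, hij], by simp [Walk.take_length, h, hij]⟩

/-- Once a subtree through `v` misses one vertex of a path from `v`, it misses all later ones. -/
theorem IsTree.add_one_sub_le_card_compl (hG : G.IsTree) {v y : V} {w : G.Walk v y}
    (hw : w.IsPath) {S : Finset V} (hS : G.ConnectedOn S) (hv : v ∈ S) {j : ℕ}
    (hj : w.getVert j ∉ S) : w.length + 1 - j ≤ Sᶜ.card := by
  rw [← Nat.card_Icc]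
  refine Finset.card_le_card_of_injOn w.getVert (fun i hi => ?_) fun a ha b hb h => ?_
  · rw [Finset.mem_coe, Finset.mem_Icc] at hi
    simp only [Finset.coe_compl, Set.mem_compl_iff, Finset.mem_coe]
    exact fun h => hj (hG.getVert_mem_of_getVert_mem hw hS hv hi.1 h)
  · rw [Finset.mem_coe, Finset.mem_Icc] at ha hb
    exact hw.getVert_injOn ha.2 hb.2 h

omit [Fintype V] [DecidableEq V] in
theorem Walk.IsPath.getVert_ne {v y : V} {w : G.Walk v y} (hw : w.IsPath) {i j : ℕ}
    (hi : i ≤ w.length) (hj : j ≤ w.length) (h : i ≠ j) : w.getVert i ≠ w.getVert j :=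
  fun e => h (hw.getVert_injOn hi hj e)

-- `S \ G.sideOf v w.snd` is the trace of `S` on the branch of the path. A subtree through
-- `w.getVert i` is recovered from this trace and from its part not cut off by `w.getVert (i + 1)`,
-- which leaves the path exactly at `w.getVert i`; everything cut off there lies in the branch.
open Classical in
theorem IsTree.card_filter_getVert_mem_le (hG : G.IsTree) {v y : V} {w : G.Walk v y}
    (hw : w.IsPath) {i : ℕ} (hi : i < w.length) :
    ((G.subtreeSetsAt v).filter (w.getVert i ∈ ·)).card ≤
      ((G.subtreeSetsAt v).filter
        fun S => w.getVert i ∈ S ∧ w.getVert (i + 1) ∉ S).card *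
      ((G.subtreeSetsAt v).image (· \ G.sideOf v w.snd)).card := by
  rw [← Finset.card_product]
  have hne : v ≠ w.getVert (i + 1) := by
    have := hw.getVert_ne (Nat.zero_le _) hi (Nat.succ_ne_zero i).symm
    simpa using this
  have hne1 : v ≠ w.snd := by
    have := hw.getVert_ne (i := 0) (j := 1) (Nat.zero_le _) (by omega) one_ne_zero.symm
    simpa using this
  have hsub : ∀ z, z ∉ G.sideOf v (w.getVert (i + 1)) → z ∉ G.sideOf v w.snd := by
    intro z hz h
    obtain ⟨S, hS, hvS, hzS, hx⟩ := mem_sideOf.1 h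
    exact hz (mem_sideOf.2 ⟨S, hS, hvS, hzS, fun h' =>
      hx (hG.getVert_mem_of_getVert_mem hw hS hvS (Nat.succ_le_succ (Nat.zero_le i)) h')⟩)
  have hmem : w.getVert i ∈ G.sideOf v (w.getVert (i + 1)) := by
    refine mem_sideOf.2 ⟨(w.take i).support.toFinset, (w.take i).connectedOn_support, by simp,
      by simp, fun h => ?_⟩
    rw [List.mem_toFinset, Walk.mem_support_iff_exists_getVert] at h
    obtain ⟨k, hk, hk'⟩ := h
    have hk'' : k ≤ i := by simpa [Walk.take_length, hi.le] using hk'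
    rw [Walk.take_getVert, min_eq_right hk''] at hk
    exact hw.getVert_ne (by omega) hi (by omega) hk
  refine Finset.card_le_card_of_injOn
    (fun S => (S ∩ G.sideOf v (w.getVert (i + 1)), S \ G.sideOf v w.snd))
    (fun S hS => ?_) fun S hS T hT h => ?_
  · obtain ⟨hS, hiS⟩ := Finset.mem_filter.1 hS
    obtain ⟨hc, hv⟩ := mem_subtreeSetsAt.1 hS
    refine Finset.mem_product.2 ⟨Finset.mem_filter.2 ⟨mem_subtreeSetsAt.2 ⟨?_, ?_⟩, ?_, ?_⟩,
      Finset.mem_image_of_mem _ hS⟩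
    · exact hG.connectedOn_inter hc (connectedOn_sideOf hne) hv (self_mem_sideOf hne)
    · exact Finset.mem_inter.2 ⟨hv, self_mem_sideOf hne⟩
    · exact Finset.mem_inter.2 ⟨hiS, hmem⟩
    · exact fun h => notMem_sideOf _ _ (Finset.mem_inter.1 h).2
  · obtain ⟨h1, h2⟩ := Prod.mk.inj h
    ext z
    have h1 := Finset.ext_iff.1 h1 z
    have h2 := Finset.ext_iff.1 h2 z
    rw [Finset.mem_inter, Finset.mem_inter] at h1
    rw [Finset.mem_sdiff, Finset.mem_sdiff] at h2
    by_cases hz : z ∈ G.sideOf v (w.getVert (i + 1))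
    · simpa only [hz, and_true] using h1
    · simpa only [hsub z hz, not_false_eq_true, and_true] using h2

open Classical in
/-- If the subtrees through `v` miss few vertices on average, then there are many possibilities for
the part of such a subtree in a branch at `v` that contains a long path. -/
theorem IsTree.sq_mul_card_le (hG : G.IsTree) {v y : V} {w : G.Walk v y} (hw : w.IsPath)
    (hlen : 4 * totalLoss (G.subtreeSetsAt v) ≤ w.length * (G.subtreeSetsAt v).card) :
    (w.length : ℝ) ^ 2 * (G.subtreeSetsAt v).card ≤
      8 * ((G.subtreeSetsAt v).image (· \ G.sideOf v w.snd)).card *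
        totalLoss (G.subtreeSetsAt v) := by
  set F := G.subtreeSetsAt v with hF
  set c := (F.image (· \ G.sideOf v w.snd)).card with hc
  set l := w.length with hl
  rcases Nat.eq_zero_or_pos l with h0 | hlpos
  · rw [h0]
    have := totalLoss_nonneg F
    norm_num
    positivity
  have hl0 : (0 : ℝ) < l := by exact_mod_cast hlpos
  set m := (l + 1) / 2 with hm
  have hm2 : (l : ℝ) ≤ 2 * m := by
    have : l ≤ 2 * m := by omega
    exact_mod_cast this
  -- `U i` collects the subtrees whose last vertex on the path is the `i`-th one. For `i < m`, in
  -- the first half of the path, such a subtree loses at least `l / 2` vertices.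
  let U : ℕ → Finset (Finset V) := fun i =>
    F.filter fun S => w.getVert i ∈ S ∧ w.getVert (i + 1) ∉ S
  have hU : ∀ i ∈ Finset.range m, (F.card : ℝ) / 2 ≤ (U i).card * c := by
    intro i hi
    rw [Finset.mem_range] at hi
    have h1 := hG.card_filter_getVert_mem_le hw (i := i) (by omega)
    rw [← hF, ← hc] at h1
    -- Missing the `i`-th vertex costs at least `l / 2`, so by `hlen` at most half of the subtrees
    -- do so.
    have h2 : ((F.filter (w.getVert i ∉ ·)).card : ℝ) * (l / 2) ≤ totalLoss F := by
      refine (card_mul_le_totalLoss fun S hS => ?_).trans (totalLoss_mono (Finset.filter_subset _ _))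
      obtain ⟨hS, hi'⟩ := Finset.mem_filter.1 hS
      obtain ⟨hc, hv⟩ := mem_subtreeSetsAt.1 hS
      have := hG.add_one_sub_le_card_compl hw hc hv hi'
      have h3 : l ≤ 2 * Sᶜ.card := by omega
      have h4 : (l : ℝ) ≤ 2 * Sᶜ.card := by exact_mod_cast h3
      linarith
    have h3 : ((F.filter (w.getVert i ∈ ·)).card : ℝ) + (F.filter (w.getVert i ∉ ·)).card =
        F.card := by
      exact_mod_cast Finset.card_filter_add_card_filter_not (s := F) (w.getVert i ∈ ·)
    have h4 : ((F.filter (w.getVert i ∉ ·)).card : ℝ) ≤ F.card / 2 := by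
      by_contra! h
      nlinarith
    have h5 : ((F.filter (w.getVert i ∈ ·)).card : ℝ) ≤ (U i).card * c := by exact_mod_cast h1
    linarith
  have hdisj : Set.PairwiseDisjoint (Finset.range m : Set ℕ) U := by
    have key : ∀ i j, i < j → Disjoint (U i) (U j) := fun i j hij =>
      Finset.disjoint_left.2 fun S h1 h2 => by
        obtain ⟨hS, -, h1⟩ := Finset.mem_filter.1 h1
        obtain ⟨-, h2, -⟩ := Finset.mem_filter.1 h2
        obtain ⟨hc, hv⟩ := mem_subtreeSetsAt.1 hS
        exact h1 (hG.getVert_mem_of_getVert_mem hw hc hv hij h2)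
    intro i _ j _ hij
    rcases lt_or_gt_of_ne hij with h | h
    · exact key i j h
    · exact (key j i h).symm
  have hsum : (∑ i ∈ Finset.range m, ((U i).card : ℝ)) * (l / 2) ≤ totalLoss F := by
    rw [← Nat.cast_sum, ← Finset.card_biUnion hdisj]
    refine (card_mul_le_totalLoss fun S hS => ?_).trans (totalLoss_mono (F' := F) fun S hS => ?_)
    · obtain ⟨i, hi, hS⟩ := Finset.mem_biUnion.1 hS
      rw [Finset.mem_range] at hi
      obtain ⟨hS, -, hi'⟩ := Finset.mem_filter.1 hS
      obtain ⟨hc, hv⟩ := mem_subtreeSetsAt.1 hS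
      have := hG.add_one_sub_le_card_compl hw hc hv hi'
      have h3 : l ≤ 2 * Sᶜ.card := by omega
      have h4 : (l : ℝ) ≤ 2 * Sᶜ.card := by exact_mod_cast h3
      linarith
    · obtain ⟨i, hi, hS⟩ := Finset.mem_biUnion.1 hS
      exact (Finset.mem_filter.1 hS).1
  have hs2 : (m : ℝ) * (F.card / 2) ≤ (∑ i ∈ Finset.range m, ((U i).card : ℝ)) * c := by
    have := Finset.card_nsmul_le_sum (Finset.range m) (fun i => ((U i).card : ℝ) * c) _ hU
    rw [Finset.card_range, nsmul_eq_mul, ← Finset.sum_mul] at this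
    exact this
  have hFc : (0 : ℝ) ≤ F.card := Nat.cast_nonneg _
  have hcc : (0 : ℝ) ≤ c := Nat.cast_nonneg _
  calc (l : ℝ) ^ 2 * F.card ≤ (m * (F.card / 2)) * (4 * l) := by nlinarith [mul_nonneg hl0.le hFc]
    _ ≤ ((∑ i ∈ Finset.range m, ((U i).card : ℝ)) * c) * (4 * l) := by gcongr
    _ = 8 * c * ((∑ i ∈ Finset.range m, ((U i).card : ℝ)) * (l / 2)) := by ring
    _ ≤ 8 * c * totalLoss F := by gcongr

-- Traces on three different branches can be prescribed independently, because subtrees through `v`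
-- can be glued at `v`.
open Classical in
theorem IsTree.prod_card_image_le (hG : G.IsTree) {v a b c : V} (hva : G.Adj v a) (hvb : G.Adj v b)
    (hvc : G.Adj v c) (hab : a ≠ b) (hac : a ≠ c) (hbc : b ≠ c) :
    ((G.subtreeSetsAt v).image (· \ G.sideOf v a)).card *
      (((G.subtreeSetsAt v).image (· \ G.sideOf v b)).card *
        ((G.subtreeSetsAt v).image (· \ G.sideOf v c)).card) ≤ (G.subtreeSetsAt v).card := by
  rw [← Finset.card_product, ← Finset.card_product]
  refine Finset.card_le_card_of_surjOn
    (fun S => (S \ G.sideOf v a, S \ G.sideOf v b, S \ G.sideOf v c)) ?_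
  rintro ⟨x, y, z⟩ h
  simp only [Finset.mem_coe, Finset.mem_product, Finset.mem_image] at h
  obtain ⟨⟨A, hA, rfl⟩, ⟨B, hB, rfl⟩, ⟨C, hC, rfl⟩⟩ := h
  have h1 := connectedOn_sideOf (G := G) hva.ne
  have h2 := connectedOn_sideOf (G := G) hvb.ne
  have h3 := connectedOn_sideOf (G := G) hvc.ne
  have m1 := self_mem_sideOf (G := G) hva.ne
  have m2 := self_mem_sideOf (G := G) hvb.ne
  have m3 := self_mem_sideOf (G := G) hvc.ne
  have hI : ∀ {S T}, S ∈ G.subtreeSetsAt v → G.ConnectedOn T → v ∈ T →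
      S ∩ T ∈ G.subtreeSetsAt v := fun hS hT hv => by
    rw [mem_subtreeSetsAt] at *
    exact ⟨hG.connectedOn_inter hS.1 hT hS.2 hv, Finset.mem_inter.2 ⟨hS.2, hv⟩⟩
  have hU : ∀ {S T}, S ∈ G.subtreeSetsAt v → T ∈ G.subtreeSetsAt v →
      S ∪ T ∈ G.subtreeSetsAt v := fun hS hT => by
    rw [mem_subtreeSetsAt] at *
    exact ⟨hS.1.union_of_mem hT.1 hS.2 hT.2, Finset.mem_union_left _ hS.2⟩
  -- Each of the three subtrees is trimmed of its parts in the other two branches before gluing.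
  refine ⟨((A ∩ G.sideOf v b) ∩ G.sideOf v c) ∪ (((B ∩ G.sideOf v a) ∩ G.sideOf v c) ∪
    ((C ∩ G.sideOf v a) ∩ G.sideOf v b)), ?_, ?_⟩
  · exact hU (hI (hI hA h2 m2) h3 m3) (hU (hI (hI hB h1 m1) h3 m3) (hI (hI hC h1 m1) h2 m2))
  · simp only [Prod.mk.injEq]
    refine ⟨?_, ?_, ?_⟩ <;>
    · ext z
      have e1 := hG.mem_sideOf_or_mem_sideOf hva hvb hab z
      have e2 := hG.mem_sideOf_or_mem_sideOf hva hvc hac z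
      have e3 := hG.mem_sideOf_or_mem_sideOf hvb hvc hbc z
      simp only [Finset.mem_sdiff, Finset.mem_union, Finset.mem_inter]
      clear hI hU
      grind

/-- A connected set that avoids `v` misses one of any two branches at `v`. -/
theorem IsTree.le_card_compl_of_notMem (hG : G.IsTree) {v y z : V} {w : G.Walk v y}
    {w' : G.Walk v z} (hw : w.IsPath) (hw' : w'.IsPath) (hn : ¬ w.Nil) (hn' : ¬ w'.Nil)
    (hne : w.snd ≠ w'.snd) {S : Finset V} (hS : G.ConnectedOn S) (hv : v ∉ S) :
    min w.length w'.length ≤ Sᶜ.card := by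
  have key : ∀ {t : V} {u : G.Walk v t}, u.IsPath → ¬ u.Nil →
      u.length = u.tail.support.toFinset.card ∧ v ∉ u.tail.support := by
    intro t u hu hnu
    constructor
    · rw [List.toFinset_card_of_nodup hu.tail.support_nodup, Walk.length_support,
        Walk.length_tail_add_one hnu]
    · rw [Walk.support_tail_of_not_nil _ hnu]
      have := hu.support_nodup
      rw [← Walk.cons_tail_support, List.nodup_cons] at this
      exact this.1
  obtain ⟨h1, h2⟩ := key hw hn
  obtain ⟨h1', h2'⟩ := key hw' hn'
  by_contra! hlt
  have hex : ∀ {A : Finset V}, Sᶜ.card < A.card → (S ∩ A).Nonempty := fun {A} h => by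
    by_contra! hempty
    refine absurd (Finset.card_le_card (s := A) (t := Sᶜ) fun x hx => ?_) (not_le.2 h)
    rw [Finset.mem_compl]
    exact fun hxS => by simpa [hempty] using Finset.mem_inter.2 ⟨hxS, hx⟩
  -- If `S` met both tails, its union with them would be a connected set avoiding `v` with two
  -- neighbours of `v`.
  have c1 := hS.union w.tail.connectedOn_support (hex (by omega))
  have c2 := c1.union w'.tail.connectedOn_support
    ((hex (A := w'.tail.support.toFinset) (by omega)).mono (by
      intro x; simp only [Finset.mem_inter, Finset.mem_union]; tauto))
  refine hne (hG.isAcyclic.eq_of_adj_of_adj c2 (v := v) ?_ ?_ ?_ (w.adj_snd hn) (w'.adj_snd hn'))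
  · simp [hv, h2, h2']
  · simp
  · simp

end Legs
end SimpleGraph

namespace SimpleGraph

/-! ### Few leaves, and a long third leg off a longest path. -/

section Leaves

variable {V : Type*} {G : SimpleGraph V}

theorem Walk.IsPath.append_of_forall {u v w : V} {p : G.Walk u v} {q : G.Walk v w}
    (hp : p.IsPath) (hq : q.IsPath) (h : ∀ z ∈ p.support, z ∈ q.support → z = v) :
    (p.append q).IsPath := by
  have hq' := hq.support_nodup
  rw [← Walk.cons_tail_support, List.nodup_cons] at hq'
  rw [Walk.isPath_def, Walk.support_append, List.nodup_append]
  refine ⟨hp.support_nodup, hq'.2, ?_⟩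
  rintro a ha _ hb rfl
  obtain rfl := h a ha (List.mem_of_mem_tail hb)
  exact hq'.1 hb

theorem Walk.snd_ne_snd_of_isPath_append {v a b : V} {r : G.Walk v a} {s : G.Walk v b}
    (h : (r.reverse.append s).IsPath) (hs : ¬ s.Nil) : r.snd ≠ s.snd := by
  have h' := h.support_nodup
  rw [Walk.support_append, List.nodup_append] at h'
  refine h'.2.2 _ (by simp) _ ?_
  rw [← Walk.support_tail_of_not_nil _ hs]
  exact Walk.start_mem_support _

theorem IsTree.length_le_diam [Finite V] (hG : G.IsTree) {u v : V} {p : G.Walk u v}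
    (hp : p.IsPath) : p.length ≤ G.diam := by
  have := hG.connected.nonempty
  obtain ⟨q, hq, hq'⟩ := hG.connected.exists_path_of_dist u v
  rw [(hG.existsUnique_path u v).unique hp hq, hq']
  exact dist_le_diam (connected_iff_ediam_ne_top.1 hG.connected)

variable [Fintype V] [DecidableEq V]

open Classical in
/-- The vertices whose removal leaves `G` connected. -/
noncomputable def leafSet (G : SimpleGraph V) : Finset V :=
  Finset.univ.filter fun y => G.ConnectedOn (Finset.univ.erase y)

theorem mem_leafSet {y : V} : y ∈ G.leafSet ↔ G.ConnectedOn (Finset.univ.erase y) := by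
  simp [leafSet]

-- Double counting of pairs of a subtree and a vertex it misses. Erasing a leaf `y` injects the
-- subtrees containing `y` into those missing `y`, together with the empty set, which accounts for
-- the `- 1`.
open Classical in
theorem IsTree.card_leafSet_mul_le (hG : G.IsTree) :
    (G.leafSet.card : ℝ) * (G.subtreeSets.card - 1) ≤ 2 * totalLoss G.subtreeSets := by
  have h1 : totalLoss G.subtreeSets =
      ∑ y : V, ((G.subtreeSets.filter (y ∉ ·)).card : ℝ) := by
    have : ∀ S : Finset V, (Sᶜ.card : ℝ) = ∑ y : V, if y ∉ S then (1 : ℝ) else 0 := fun S => by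
      rw [Finset.sum_boole]
      congr 2
      ext
      simp
    simp only [totalLoss, this]
    rw [Finset.sum_comm]
    simp only [Finset.sum_boole]
  have h2 : ∀ y ∈ G.leafSet, ((G.subtreeSets.card : ℝ) - 1) / 2 ≤
      (G.subtreeSets.filter (y ∉ ·)).card := by
    intro y hy
    rw [mem_leafSet] at hy
    have h3 : (G.subtreeSets.filter (y ∈ ·)).card ≤
        (insert ∅ (G.subtreeSets.filter (y ∉ ·))).card := by
      refine Finset.card_le_card_of_injOn (fun S => S.erase y) (fun S hS => ?_)
        fun S hS T hT h => ?_
      · obtain ⟨hS, hyS⟩ := Finset.mem_filter.1 hS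
        rcases (S.erase y).eq_empty_or_nonempty with h | ⟨x, hx⟩
        · simp [h]
        · refine Finset.mem_insert_of_mem (Finset.mem_filter.2 ⟨?_, by simp⟩)
          have e : S.erase y = S ∩ Finset.univ.erase y := by
            ext z
            simp [and_comm]
          rw [mem_subtreeSets] at hS ⊢
          simp only [e]
          exact hG.connectedOn_inter hS hy (Finset.mem_of_mem_erase hx)
            (Finset.mem_erase.2 ⟨Finset.ne_of_mem_erase hx, Finset.mem_univ _⟩)
      · have hS' := (Finset.mem_filter.1 hS).2
        have hT' := (Finset.mem_filter.1 hT).2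
        simp only at h
        rw [← Finset.insert_erase hS', h, Finset.insert_erase hT']
    have h4 := Finset.card_filter_add_card_filter_not (s := G.subtreeSets) (y ∈ ·)
    have h5 := h3.trans (Finset.card_insert_le _ _)
    have h6 : G.subtreeSets.card ≤ 2 * (G.subtreeSets.filter (y ∉ ·)).card + 1 := by omega
    have h7 : (G.subtreeSets.card : ℝ) ≤ 2 * (G.subtreeSets.filter (y ∉ ·)).card + 1 := by
      exact_mod_cast h6
    linarith
  have h8 := Finset.card_nsmul_le_sum _ _ _ h2
  have h9 : ∑ y ∈ G.leafSet, ((G.subtreeSets.filter (y ∉ ·)).card : ℝ) ≤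
      ∑ y : V, ((G.subtreeSets.filter (y ∉ ·)).card : ℝ) :=
    Finset.sum_le_sum_of_subset_of_nonneg (Finset.subset_univ _) fun _ _ _ => Nat.cast_nonneg _
  rw [nsmul_eq_mul] at h8
  linarith

/-- Such a `y` is a vertex added last when the component of `p` in the complement of `z` is grown to
the whole tree. -/
theorem IsTree.exists_leaf_forall_mem (hG : G.IsTree) {p z : V} (hpz : p ≠ z) :
    ∃ y ∈ G.leafSet, ∀ S, G.ConnectedOn S → p ∈ S → y ∈ S → z ∈ S := by
  obtain ⟨y, -, hy, hc⟩ := (connectedOn_sideOf (G := G) hpz).exists_erase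
    (connectedOn_univ hG.connected)
    (Finset.ssubset_univ_iff.2 fun h => notMem_sideOf (G := G) p z (h ▸ Finset.mem_univ z))
  refine ⟨y, mem_leafSet.2 hc, fun S hS hp hyS => ?_⟩
  by_contra hz
  exact hy (mem_sideOf.2 ⟨S, hS, hp, hyS, hz⟩)

/-- A tree that is not a path has a vertex with three long branches: two of them make up a
longest path, and the third one is long compared to the number of vertices outside that path. -/
theorem IsTree.exists_three_paths (hG : G.IsTree) (hd : G.diam + 1 < Fintype.card V) :
    ∃ (v y₁ y₂ y₃ : V) (w₁ : G.Walk v y₁) (w₂ : G.Walk v y₂) (w₃ : G.Walk v y₃),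
      w₁.IsPath ∧ w₂.IsPath ∧ w₃.IsPath ∧ 0 < w₃.length ∧ w₃.length ≤ w₁.length ∧
      w₃.length ≤ w₂.length ∧ w₁.snd ≠ w₂.snd ∧ w₁.snd ≠ w₃.snd ∧ w₂.snd ≠ w₃.snd ∧
      w₁.length + w₂.length = G.diam ∧
      Fintype.card V ≤ G.diam + 1 + G.leafSet.card * w₃.length := by
  have := hG.connected.nonempty
  obtain ⟨p, q, hpq⟩ := G.exists_dist_eq_diam
  obtain ⟨P, hP, hPl⟩ := hG.connected.exists_path_of_dist p q
  rw [hpq] at hPl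
  choose f hf _ using fun y => hG.existsUnique_path p y
  set K := P.support.toFinset with hK
  have hKcard : K.card = G.diam + 1 := by
    rw [hK, List.toFinset_card_of_nodup hP.support_nodup, Walk.length_support, hPl]
  -- Every vertex off the longest path lies on the path from `p` to some leaf, so some leaf path has
  -- at least the average number of vertices off `K`.
  have hcover : Kᶜ ⊆ G.leafSet.biUnion fun y => (f y).support.toFinset \ K := by
    intro z hz
    rw [Finset.mem_compl] at hz
    obtain ⟨y, hy, h⟩ := hG.exists_leaf_forall_mem (p := p) (z := z) (by
      rintro rfl; exact hz (by simp [hK]))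
    exact Finset.mem_biUnion.2 ⟨y, hy, Finset.mem_sdiff.2
      ⟨h _ (f y).connectedOn_support (by simp) (by simp), hz⟩⟩
  have hKc : Kᶜ.card = Fintype.card V - (G.diam + 1) := by rw [Finset.card_compl, hKcard]
  have hne : G.leafSet.Nonempty := by
    by_contra h
    rw [Finset.not_nonempty_iff_eq_empty] at h
    rw [h, Finset.biUnion_empty, Finset.subset_empty, ← Finset.card_eq_zero] at hcover
    omega
  obtain ⟨y, hy, hmax⟩ := G.leafSet.exists_max_image
    (fun y => ((f y).support.toFinset \ K).card) hne
  have hcard := (Finset.card_le_card hcover).trans (Finset.card_biUnion_le_card_mul _ _ _ hmax)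
  set w := f y
  -- The `j`-th vertex is where the chosen leaf path leaves `K` for good; it serves as `v`.
  set j := Nat.findGreatest (fun i => w.getVert i ∈ K) w.length with hj
  have hjK : w.getVert j ∈ K :=
    Nat.findGreatest_spec (P := fun i => w.getVert i ∈ K) (Nat.zero_le _) (by simp [hK])
  have hjl : j ≤ w.length := Nat.findGreatest_le _
  have hgt : ∀ i, j < i → i ≤ w.length → w.getVert i ∉ K := fun i h1 h2 =>
    Nat.findGreatest_is_greatest h1 h2
  have hc : (w.support.toFinset \ K).card ≤ w.length - j := by
    rw [← Nat.card_Ioc]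
    refine (Finset.card_le_card (t := (Finset.Ioc j w.length).image w.getVert)
      fun z hz => ?_).trans Finset.card_image_le
    rw [Finset.mem_sdiff, List.mem_toFinset, Walk.mem_support_iff_exists_getVert] at hz
    obtain ⟨⟨i, rfl, hi⟩, hz⟩ := hz
    refine Finset.mem_image_of_mem _ (Finset.mem_Ioc.2 ⟨?_, hi⟩)
    by_contra! hij
    refine hz (hG.getVert_mem_of_getVert_mem (hf y) P.connectedOn_support (by simp) hij hjK)
  have hvP : w.getVert j ∈ P.support := by simpa [hK] using hjK
  have hw3K : ∀ z ∈ (w.drop j).support, z ∈ K → z = w.getVert j := by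
    intro z hz hzK
    rw [Walk.mem_support_iff_exists_getVert] at hz
    obtain ⟨i, rfl, hi⟩ := hz
    rw [Walk.drop_length] at hi
    rw [Walk.drop_getVert] at hzK ⊢
    rcases Nat.eq_zero_or_pos i with rfl | hi0
    · simp
    · exact absurd hzK (hgt _ (by omega) (by omega))
  have hspec : ((P.takeUntil _ hvP).reverse.reverse.append (P.dropUntil _ hvP)).IsPath := by
    rw [Walk.reverse_reverse, Walk.take_spec]
    exact hP
  have hlen : (P.takeUntil _ hvP).reverse.length + (P.dropUntil _ hvP).length = G.diam := by
    rw [← hPl, Walk.length_reverse, ← Walk.length_append, Walk.take_spec]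
  have p1 : (P.takeUntil _ hvP).reverse.IsPath := (hP.takeUntil hvP).reverse
  have p2 : (P.dropUntil _ hvP).IsPath := hP.dropUntil hvP
  have p3 : (w.drop j).IsPath := (hf y).drop j
  have q13 : ((P.takeUntil _ hvP).reverse.reverse.append (w.drop j)).IsPath :=
    p1.reverse.append_of_forall p3 fun z hz hz' => hw3K z hz' (by
      rw [Walk.reverse_reverse] at hz
      exact List.mem_toFinset.2 (P.support_takeUntil_subset_support hvP hz))
  have q23 : ((P.dropUntil _ hvP).reverse.append (w.drop j)).IsPath :=
    p2.reverse.append_of_forall p3 fun z hz hz' => hw3K z hz' (by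
      rw [Walk.support_reverse, List.mem_reverse] at hz
      exact List.mem_toFinset.2 (P.support_dropUntil_subset_support hvP hz))
  -- Replacing either half of the longest path by the third leg cannot exceed the diameter, so the
  -- third leg is the shortest of the three.
  have l13 := hG.length_le_diam q13
  have l23 := hG.length_le_diam q23
  rw [Walk.length_append, Walk.length_reverse] at l13 l23
  have hl3 : (w.drop j).length = w.length - j := Walk.drop_length _ _
  have hpos : 0 < (w.drop j).length := by
    rw [hl3]
    by_contra h0
    rw [Nat.eq_zero_of_not_pos h0, Nat.le_zero] at hc
    rw [hc] at hcard
    omega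
  have n2 : ¬ (P.dropUntil _ hvP).Nil := by
    rw [← Walk.length_eq_zero_iff]
    omega
  have n3 : ¬ (w.drop j).Nil := by
    rw [← Walk.length_eq_zero_iff]
    omega
  refine ⟨_, _, _, _, (P.takeUntil _ hvP).reverse, P.dropUntil _ hvP, w.drop j, p1, p2, p3, hpos,
    by omega, by omega, Walk.snd_ne_snd_of_isPath_append hspec n2,
    Walk.snd_ne_snd_of_isPath_append q13 n3, Walk.snd_ne_snd_of_isPath_append q23 n3, hlen, ?_⟩
  have := hcard.trans (Nat.mul_le_mul_left _ hc)
  rw [hl3]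
  omega

end Leaves
end SimpleGraph

namespace SimpleGraph

/-! ### Consequences of a small mean loss. -/

section MeanLoss

variable {V : Type*} [Fintype V] [DecidableEq V] {G : SimpleGraph V}

omit [DecidableEq V] in
theorem card_le_card_subtreeSets (G : SimpleGraph V) :
    Fintype.card V ≤ G.subtreeSets.card := by
  rw [← Finset.card_univ]
  exact Finset.card_le_card_of_injOn (fun v => {v})
    (fun v _ => mem_subtreeSets.2 (connectedOn_singleton v))
    fun a _ b _ h => Finset.singleton_injective h

omit [DecidableEq V] in
theorem IsTree.card_subtreeSets_pos (hG : G.IsTree) : 0 < G.subtreeSets.card := by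
  have := hG.connected.nonempty
  exact Fintype.card_pos.trans_le G.card_le_card_subtreeSets

theorem IsTree.totalLoss_eq (hG : G.IsTree) : totalLoss G.subtreeSets =
    (Fintype.card V - G.meanSubtreeOrder) * G.subtreeSets.card := by
  have h0 : (G.subtreeSets.card : ℝ) ≠ 0 := by exact_mod_cast hG.card_subtreeSets_pos.ne'
  rw [meanSubtreeOrder, sub_mul, div_mul_cancel₀ _ h0, totalLoss, mul_comm, ← nsmul_eq_mul,
    ← Finset.sum_const, ← Finset.sum_sub_distrib]
  refine Finset.sum_congr rfl fun S _ => ?_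
  rw [Finset.card_compl, Nat.cast_sub (Finset.card_le_univ S)]

theorem IsTree.card_leafSet_le (hG : G.IsTree) (hV : 2 ≤ Fintype.card V) :
    (G.leafSet.card : ℝ) ≤ 4 * (Fintype.card V - G.meanSubtreeOrder) := by
  have h1 := hG.card_leafSet_mul_le
  rw [hG.totalLoss_eq] at h1
  have h2 : (2 : ℝ) ≤ G.subtreeSets.card := by
    exact_mod_cast hV.trans G.card_le_card_subtreeSets
  have h3 : (0 : ℝ) ≤ G.leafSet.card := Nat.cast_nonneg _
  by_contra! h
  nlinarith

open Classical in
/-- Three long branches at a vertex of a tree force the mean subtree order to be small. -/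
theorem IsTree.logb_le_mul_of_three_paths (hG : G.IsTree) {v y₁ y₂ y₃ : V} {w₁ : G.Walk v y₁}
    {w₂ : G.Walk v y₂} {w₃ : G.Walk v y₃} (h₁ : w₁.IsPath) (h₂ : w₂.IsPath) (h₃ : w₃.IsPath)
    (hpos : 0 < w₃.length) (h31 : w₃.length ≤ w₁.length) (h32 : w₃.length ≤ w₂.length)
    (n12 : w₁.snd ≠ w₂.snd) (n13 : w₁.snd ≠ w₃.snd) (n23 : w₂.snd ≠ w₃.snd) {B : ℝ}
    (hB : Fintype.card V - G.meanSubtreeOrder ≤ B) (hBl : 8 * B ≤ w₃.length) :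
    (1 - B / w₃.length) * (Real.logb 2 ((w₁.length * w₂.length * w₃.length) ^ 2 / (16 * B) ^ 3)) ≤
      2 * B := by
  have nil₁ : ¬ w₁.Nil := by rw [← Walk.length_eq_zero_iff]; omega
  have nil₂ : ¬ w₂.Nil := by rw [← Walk.length_eq_zero_iff]; omega
  have nil₃ : ¬ w₃.Nil := by rw [← Walk.length_eq_zero_iff]; omega
  set F := G.subtreeSetsAt v with hF
  set N : ℝ := (G.subtreeSets.card : ℝ) with hN
  have hN0 : 0 < N := by rw [hN]; exact_mod_cast hG.card_subtreeSets_pos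
  have hΛ : totalLoss G.subtreeSets ≤ B * N := by
    rw [hG.totalLoss_eq]
    gcongr
  have hc : (0 : ℝ) < w₃.length := by exact_mod_cast hpos
  have hca : (w₃.length : ℝ) ≤ w₁.length := by exact_mod_cast h31
  have hcb : (w₃.length : ℝ) ≤ w₂.length := by exact_mod_cast h32
  have hF1 : (N - F.card) * w₃.length ≤ B * N := by
    have e : N - F.card = (G.subtreeSets.filter (v ∉ ·)).card := by
      have := Finset.card_filter_add_card_filter_not (s := G.subtreeSets) (v ∈ ·)
      rw [hN, ← this, hF, subtreeSetsAt]
      push_cast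
      ring_nf
    rw [e]
    refine (card_mul_le_totalLoss fun S hS => ?_).trans
      ((totalLoss_mono (Finset.filter_subset _ _)).trans hΛ)
    obtain ⟨hS, hv⟩ := Finset.mem_filter.1 hS
    have := hG.le_card_compl_of_notMem h₁ h₃ nil₁ nil₃ n13 (mem_subtreeSets.1 hS) hv
    rw [min_eq_right h31] at this
    exact_mod_cast this
  have hB0 : 0 ≤ B := by
    have := (totalLoss_nonneg G.subtreeSets).trans hΛ
    by_contra! h
    nlinarith
  have hBc : B / w₃.length ≤ 1 / 8 := by
    rw [div_le_iff₀ hc]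
    linarith
  have hF2 : (1 - B / w₃.length) * N ≤ F.card := by
    have : N - F.card ≤ B * N / w₃.length := by rwa [le_div_iff₀ hc]
    rw [sub_mul, div_mul_eq_mul_div]
    linarith
  have hF3 : N ≤ 2 * F.card := by nlinarith
  have hF0 : (0 : ℝ) < F.card := by linarith
  have hΛF : totalLoss F ≤ B * N := (totalLoss_mono (by
    rw [hF, subtreeSetsAt]
    exact Finset.filter_subset _ _)).trans hΛ
  have hΛ4 : 4 * totalLoss F ≤ w₃.length * F.card := by nlinarith
  have e₁ := hG.sq_mul_card_le h₁ (hΛ4.trans (by gcongr))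
  have e₂ := hG.sq_mul_card_le h₂ (hΛ4.trans (by gcongr))
  have e₃ := hG.sq_mul_card_le h₃ hΛ4
  have e := hG.prod_card_image_le (w₁.adj_snd nil₁) (w₂.adj_snd nil₂) (w₃.adj_snd nil₃) n12 n13 n23
  rw [← hF] at e₁ e₂ e₃ e
  set c₁ := (F.image (· \ G.sideOf v w₁.snd)).card
  set c₂ := (F.image (· \ G.sideOf v w₂.snd)).card
  set c₃ := (F.image (· \ G.sideOf v w₃.snd)).card
  -- The mean loss over `F` is at most `2 * B` because `N ≤ 2 * F.card`; this turns the constant `8`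
  -- into `16`.
  have hl : ∀ {l c : ℕ}, (l : ℝ) ^ 2 * F.card ≤ 8 * c * totalLoss F →
      (l : ℝ) ^ 2 ≤ 16 * B * c := by
    intro l c h
    have h1 : 8 * (c : ℝ) * totalLoss F ≤ 8 * c * (B * (2 * F.card)) := by gcongr; nlinarith
    have h2 : (l : ℝ) ^ 2 * F.card ≤ 16 * B * c * F.card := by linarith
    exact le_of_mul_le_mul_right h2 hF0
  have hprod : ((w₁.length : ℝ) * w₂.length * w₃.length) ^ 2 ≤ (16 * B) ^ 3 * F.card := by
    have hcard : (c₁ : ℝ) * (c₂ * c₃) ≤ F.card := by exact_mod_cast e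
    calc ((w₁.length : ℝ) * w₂.length * w₃.length) ^ 2
        = (w₁.length : ℝ) ^ 2 * (w₂.length : ℝ) ^ 2 * (w₃.length : ℝ) ^ 2 := by ring
      _ ≤ (16 * B * c₁) * (16 * B * c₂) * (16 * B * c₃) := by
        gcongr
        · exact hl e₁
        · exact hl e₂
        · exact hl e₃
      _ = (16 * B) ^ 3 * (c₁ * (c₂ * c₃)) := by ring
      _ ≤ (16 * B) ^ 3 * F.card := by gcongr
  have hpos' : (0 : ℝ) < ((w₁.length : ℝ) * w₂.length * w₃.length) ^ 2 := by
    have := hc.trans_le hca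
    have := hc.trans_le hcb
    positivity
  have hBpos : 0 < (16 * B) ^ 3 := by
    by_contra! h
    nlinarith
  have hlog : Real.logb 2 (((w₁.length : ℝ) * w₂.length * w₃.length) ^ 2 / (16 * B) ^ 3) ≤
      Real.logb 2 F.card := by
    refine Real.logb_le_logb_of_le one_lt_two (by positivity) ?_
    rw [div_le_iff₀ hBpos]
    linarith
  have hent := hG.card_subtreeSetsAt_mul_logb_le v
  rw [← hF] at hent
  have hx : 0 ≤ 1 - B / w₃.length := by linarith
  have hlog0 : 0 ≤ Real.logb 2 F.card := by
    refine Real.logb_nonneg one_lt_two ?_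
    have : 0 < F.card := by exact_mod_cast hF0
    exact_mod_cast this
  refine (mul_le_mul_of_nonneg_left hlog hx).trans (le_of_mul_le_mul_right ?_ hN0)
  calc (1 - B / w₃.length) * Real.logb 2 F.card * N
      = ((1 - B / w₃.length) * N) * Real.logb 2 F.card := by ring
    _ ≤ F.card * Real.logb 2 F.card := by gcongr
    _ ≤ 2 * totalLoss F := hent
    _ ≤ 2 * B * N := by linarith

end MeanLoss
end SimpleGraph

namespace SimpleGraph

/-! ### The mean loss of a double broom. -/

section DoubleBroom

/-- The graph on `Fin n` that joins every nonzero vertex `i` to `f i`. -/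
def parentGraph {n : ℕ} [NeZero n] (f : Fin n → Fin n) : SimpleGraph (Fin n) :=
  fromRel fun i j => i ≠ 0 ∧ f i = j

theorem parentGraph_adj {n : ℕ} [NeZero n] {f : Fin n → Fin n} (hf : ∀ i ≠ 0, f i < i)
    {a b : Fin n} : (parentGraph f).Adj a b ↔ a ≠ 0 ∧ f a = b ∨ b ≠ 0 ∧ f b = a := by
  rw [parentGraph, fromRel_adj, and_iff_right_iff_imp]
  rintro (⟨h, rfl⟩ | ⟨h, rfl⟩)
  · exact (hf a h).ne'
  · exact (hf b h).ne

theorem connectedOn_parentGraph {n : ℕ} [NeZero n] {f : Fin n → Fin n} (hf : ∀ i ≠ 0, f i < i)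
    {S : Finset (Fin n)} (h0 : 0 ∈ S) (hS : ∀ i ∈ S, i ≠ 0 → f i ∈ S) :
    (parentGraph f).ConnectedOn S := by
  refine connectedOn_of_forall_exists h0 fun z => ?_
  induction z using WellFoundedLT.induction with
  | _ z ih =>
    intro hz
    rcases eq_or_ne z 0 with rfl | hz0
    · exact ⟨{0}, by simpa using h0, connectedOn_singleton 0, by simp, by simp⟩
    · obtain ⟨R, hRS, hR, h0R, hfR⟩ := ih _ (hf z hz0) (hS z hz hz0)
      exact ⟨insert z R, Finset.insert_subset hz hRS,
        hR.insert hfR ((parentGraph_adj hf).2 (Or.inr ⟨hz0, rfl⟩)),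
        Finset.mem_insert_of_mem h0R, Finset.mem_insert_self _ _⟩

/-- Descending along `f` reaches `0`, so the graph is connected; its edges are indexed by nonzero
vertices, so there are at most `n - 1` of them. -/
theorem isTree_parentGraph {n : ℕ} [NeZero n] {f : Fin n → Fin n} (hf : ∀ i ≠ 0, f i < i) :
    (parentGraph f).IsTree := by
  have hc : (parentGraph f).Connected := by
    have := connectedOn_parentGraph hf (Finset.mem_univ 0) fun _ _ _ => Finset.mem_univ _
    rw [ConnectedOn, Finset.coe_univ] at this
    exact (Iso.connected_iff (induceUnivIso _)).1 this
  refine isTree_iff_connected_and_card.2 ⟨hc, le_antisymm ?_ hc.card_vert_le_card_edgeSet_add_one⟩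
  have h1 : (parentGraph f).edgeSet ⊆ (fun i => s(i, f i)) '' {i | i ≠ 0} := by
    intro e
    induction e with
    | _ a b =>
      rw [mem_edgeSet, parentGraph_adj hf]
      rintro (⟨h, rfl⟩ | ⟨h, rfl⟩)
      · exact ⟨a, h, rfl⟩
      · exact ⟨b, h, Sym2.eq_swap⟩
  have h2 := (Set.ncard_le_ncard h1 (Set.toFinite _)).trans (Set.ncard_image_le (Set.toFinite _))
  have h3 : ({i | i ≠ 0} : Set (Fin n)).ncard + 1 = Nat.card (Fin n) := by
    have := Set.ncard_add_ncard_compl ({0} : Set (Fin n))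
    rw [Set.ncard_singleton, add_comm] at this
    exact this
  rw [← h3, Nat.card_coe_set_eq]
  exact Nat.add_le_add_right h2 1

variable {m r : ℕ}

/-- The neighbour of `i` towards `0` in a double broom with vertices `0, …, m - 1` on its path,
then `r` leaves at `0`, and the remaining vertices leaves at `m - 1`. -/
def broomParent (m r i : ℕ) : ℕ := if i < m then i - 1 else if i < m + r then 0 else m - 1

theorem broomParent_lt (hm : 0 < m) {i : ℕ} (hi : i ≠ 0) : broomParent m r i < i := by
  unfold broomParent
  split_ifs <;> omega

/-- The double broom with `m` vertices on its path and `r` leaves at either end. -/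
def doubleBroom (m r : ℕ) [NeZero (m + 2 * r)] : SimpleGraph (Fin (m + 2 * r)) :=
  parentGraph fun i => if h : broomParent m r i < m + 2 * r then ⟨broomParent m r i, h⟩ else 0

variable [NeZero (m + 2 * r)]

/-- For `0 < m` the default value `0` in the definition is never used. -/
theorem doubleBroom_parent_val (hm : 0 < m) (i : Fin (m + 2 * r)) :
    ((if h : broomParent m r i < m + 2 * r then ⟨broomParent m r i, h⟩ else 0 :
      Fin (m + 2 * r)) : ℕ) = broomParent m r i := by
  have : broomParent m r i < m + 2 * r := by
    have := i.2
    unfold broomParent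
    split_ifs <;> omega
  rw [dif_pos this]

theorem doubleBroom_parent_lt (hm : 0 < m) (i : Fin (m + 2 * r)) (hi : i ≠ 0) :
    (if h : broomParent m r i < m + 2 * r then ⟨broomParent m r i, h⟩ else 0 :
      Fin (m + 2 * r)) < i := by
  rw [Fin.lt_def, doubleBroom_parent_val hm]
  exact broomParent_lt hm (by rwa [Fin.val_ne_zero_iff])

theorem isTree_doubleBroom (hm : 0 < m) : (doubleBroom m r).IsTree :=
  isTree_parentGraph (doubleBroom_parent_lt hm)

theorem doubleBroom_adj (hm : 0 < m) {a b : Fin (m + 2 * r)} : (doubleBroom m r).Adj a b ↔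
    (a : ℕ) ≠ 0 ∧ broomParent m r a = b ∨ (b : ℕ) ≠ 0 ∧ broomParent m r b = a := by
  rw [doubleBroom, parentGraph_adj (doubleBroom_parent_lt hm), Fin.ext_iff, Fin.ext_iff,
    doubleBroom_parent_val hm, doubleBroom_parent_val hm, Fin.val_ne_zero_iff, Fin.val_ne_zero_iff]

variable {S : Finset (Fin (m + 2 * r))}

theorem exists_broomParent_mem (hm : 0 < m) (hS : (doubleBroom m r).ConnectedOn S)
    {x y : Fin (m + 2 * r)} (hx : x ∈ S) (hy : y ∈ S) (hxy : y ≠ x) (hmx : m ≤ x) :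
    ∃ z ∈ S, (z : ℕ) = broomParent m r x := by
  obtain ⟨a, ha, b, hb, rfl, hba, hab⟩ :=
    hS.exists_adj_of_mem_of_notMem {x} hx hy rfl hxy
  rcases (doubleBroom_adj hm).1 hab with ⟨-, h⟩ | ⟨h0, h⟩
  · exact ⟨b, hb, h.symm⟩
  · exfalso
    unfold broomParent at h
    split_ifs at h <;> omega

theorem mem_of_lt_of_lt (hm : 0 < m) (hS : (doubleBroom m r).ConnectedOn S)
    {i k j : Fin (m + 2 * r)} (hi : i ∈ S) (hj : j ∈ S) (hik : i < k) (hkj : k < j)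
    (hjm : (j : ℕ) < m) : k ∈ S := by
  by_contra hk
  -- The path vertices before `k`, together with the leaves at `0`, are joined to the rest only
  -- through `k`.
  obtain ⟨a, ha, b, hb, haA, hbA, hab⟩ := hS.exists_adj_of_mem_of_notMem
    {z : Fin (m + 2 * r) | z < k ∨ m ≤ z.1 ∧ z.1 < m + r} hi hj (Or.inl hik) (by
      simp only [Set.mem_ofPred_eq, Fin.lt_def] at *
      omega)
  have hak : a.1 ≠ k.1 := fun h => hk (Fin.ext h ▸ ha)
  have hbk : b.1 ≠ k.1 := fun h => hk (Fin.ext h ▸ hb)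
  rw [doubleBroom_adj hm] at hab
  simp only [Set.mem_ofPred_eq, Fin.lt_def] at *
  unfold broomParent at hab
  split_ifs at hab <;> omega

open Classical in
/-- The connected sets of a double broom that do not contain its path. -/
theorem mem_of_not_path_subset (hm : 0 < m) (hS : (doubleBroom m r).ConnectedOn S)
    (hP : ¬ Finset.univ.filter (fun z : Fin (m + 2 * r) => z.1 < m) ⊆ S) :
    S ∈ (Finset.image₂ (fun X (k : Fin (m + 2 * r)) => X ∪ Finset.univ.filter (· < k))
        (Finset.univ.filter fun z : Fin (m + 2 * r) => m ≤ z.1 ∧ z.1 < m + r).powerset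
        Finset.univ ∪
      Finset.image₂ (fun X (k : Fin (m + 2 * r)) =>
          X ∪ Finset.univ.filter fun z => k < z ∧ z.1 < m)
        (Finset.univ.filter fun z : Fin (m + 2 * r) => m + r ≤ z.1).powerset Finset.univ) ∪
      (Finset.image₂ (fun i j => Finset.Icc i j) Finset.univ Finset.univ ∪
        Finset.univ.image fun z => {z}) := by
  simp only [Finset.mem_union]
  -- `D` is the missed part of the path. If `S` contains `0`, it meets the path exactly below `min
  -- D` and has leaves only at `0`; symmetrically for `m - 1` and `max D`. Otherwise `S` is an
  -- interval of the path or a single leaf.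
  set D := (Finset.univ.filter fun z : Fin (m + 2 * r) => z.1 < m ∧ z ∉ S) with hD
  have hDne : D.Nonempty := by
    obtain ⟨z, hz, hzS⟩ := Finset.not_subset.1 hP
    exact ⟨z, by simpa [hD, hzS] using hz⟩
  have hmin := D.min'_mem hDne
  have hmax := D.max'_mem hDne
  set k := D.min' hDne with hk
  set k' := D.max' hDne with hk'
  simp only [hD, Finset.mem_filter, Finset.mem_univ, true_and] at hmin hmax
  by_cases h0 : ∃ z ∈ S, z.1 = 0
  · obtain ⟨o, ho, ho0⟩ := h0
    left; left
    have hok : o < k := by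
      rw [Fin.lt_def]
      have : o.1 ≠ k.1 := fun h => hmin.2 (Fin.ext h ▸ ho)
      omega
    have hlast : ∀ z ∈ S, z.1 < m → z < k := by
      intro z hz hzm
      by_contra hle
      have : z ≠ k := fun h => hmin.2 (h ▸ hz)
      exact hmin.2 (mem_of_lt_of_lt hm hS ho hz hok (lt_of_le_of_ne (not_lt.1 hle) this.symm) hzm)
    refine Finset.mem_image₂.2 ⟨S.filter (fun z => m ≤ z.1), ?_, k, Finset.mem_univ _, ?_⟩
    · rw [Finset.mem_powerset]
      intro z hz
      obtain ⟨hz, hzm⟩ := Finset.mem_filter.1 hz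
      simp only [Finset.mem_filter, Finset.mem_univ, true_and]
      refine ⟨hzm, ?_⟩
      by_contra! h
      obtain ⟨y, hy, hy'⟩ := exists_broomParent_mem hm hS hz ho
        (fun h => by have := Fin.ext_iff.1 h; omega) hzm
      rw [broomParent, if_neg (by omega), if_neg (by omega)] at hy'
      have := hlast y hy (by omega)
      rw [Fin.lt_def] at this
      omega
    · ext z
      simp only [Finset.mem_union, Finset.mem_filter, Finset.mem_univ, true_and]
      constructor
      · rintro (h | h)
        · exact h.1
        · by_contra hzS
          have hzm : z.1 < m := (Fin.lt_def.1 h).trans hmin.1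
          exact absurd (D.min'_le z (by simp [hD, hzS, hzm])) (not_le.2 h)
      · intro hz
        rcases lt_or_ge z.1 m with h | h
        · exact Or.inr (hlast z hz h)
        · exact Or.inl ⟨hz, h⟩
  by_cases h1 : ∃ z ∈ S, z.1 = m - 1
  · obtain ⟨o, ho, ho0⟩ := h1
    left; right
    have hok : k' < o := by
      rw [Fin.lt_def]
      have : o.1 ≠ k'.1 := fun h => hmax.2 (Fin.ext h ▸ ho)
      omega
    have hfirst : ∀ z ∈ S, z.1 < m → k' < z := by
      intro z hz hzm
      by_contra hle
      have : z ≠ k' := fun h => hmax.2 (h ▸ hz)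
      exact hmax.2 (mem_of_lt_of_lt hm hS hz ho (lt_of_le_of_ne (not_lt.1 hle) this) hok
        (by omega))
    refine Finset.mem_image₂.2 ⟨S.filter (fun z => m ≤ z.1), ?_, k', Finset.mem_univ _, ?_⟩
    · rw [Finset.mem_powerset]
      intro z hz
      obtain ⟨hz, hzm⟩ := Finset.mem_filter.1 hz
      simp only [Finset.mem_filter, Finset.mem_univ, true_and]
      by_contra! h
      obtain ⟨y, hy, hy'⟩ := exists_broomParent_mem hm hS hz ho
        (fun h => by have := Fin.ext_iff.1 h; omega) hzm
      rw [broomParent, if_neg (by omega), if_pos (by omega)] at hy'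
      exact h0 ⟨y, hy, hy'⟩
    · ext z
      simp only [Finset.mem_union, Finset.mem_filter, Finset.mem_univ, true_and]
      constructor
      · rintro (h | h)
        · exact h.1
        · by_contra hzS
          exact absurd (D.le_max' z (by simp [hD, hzS, h.2])) (not_le.2 h.1)
      · intro hz
        rcases lt_or_ge z.1 m with h | h
        · exact Or.inr ⟨hfirst z hz h, h⟩
        · exact Or.inl ⟨hz, h⟩
  right
  by_cases h2 : ∃ z ∈ S, m ≤ z.1
  · obtain ⟨z, hz, hzm⟩ := h2
    right
    refine Finset.mem_image.2 ⟨z, Finset.mem_univ _, ?_⟩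
    symm
    rw [Finset.eq_singleton_iff_unique_mem]
    refine ⟨hz, fun y hy => ?_⟩
    by_contra hyz
    obtain ⟨x, hx, hx'⟩ := exists_broomParent_mem hm hS hz hy hyz hzm
    rw [broomParent, if_neg (by omega)] at hx'
    split_ifs at hx'
    · exact h0 ⟨x, hx, hx'⟩
    · exact h1 ⟨x, hx, hx'⟩
  · push Not at h2
    left
    refine Finset.mem_image₂.2 ⟨S.min' hS.nonempty, Finset.mem_univ _, S.max' hS.nonempty,
      Finset.mem_univ _, ?_⟩
    ext z
    rw [Finset.mem_Icc]
    refine ⟨fun ⟨h3, h4⟩ => ?_, fun h => ⟨S.min'_le _ h, S.le_max' _ h⟩⟩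
    rcases h3.eq_or_lt with rfl | h3
    · exact S.min'_mem _
    rcases h4.eq_or_lt with rfl | h4
    · exact S.max'_mem _
    exact mem_of_lt_of_lt hm hS (S.min'_mem _) (S.max'_mem _) h3 h4 (h2 _ (S.max'_mem _))

theorem card_filter_val_mem_Ico_le {n : ℕ} (a b : ℕ) :
    (Finset.univ.filter fun z : Fin n => a ≤ z.1 ∧ z.1 < b).card ≤ b - a := by
  rw [← Nat.card_Ico]
  exact Finset.card_le_card_of_injOn Fin.val (fun z hz => by simpa using hz)
    Fin.val_injective.injOn

open Classical in
theorem card_filter_not_path_subset_le (hm : 0 < m) :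
    ((doubleBroom m r).subtreeSets.filter
      (¬ Finset.univ.filter (fun z : Fin (m + 2 * r) => z.1 < m) ⊆ ·)).card ≤
      (2 ^ r * (m + 2 * r) + 2 ^ r * (m + 2 * r)) +
        ((m + 2 * r) * (m + 2 * r) + (m + 2 * r)) := by
  refine (Finset.card_le_card fun S hS => mem_of_not_path_subset hm
    (mem_subtreeSets.1 (Finset.mem_filter.1 hS).1) (Finset.mem_filter.1 hS).2).trans ?_
  refine (Finset.card_union_le _ _).trans
    (add_le_add ((Finset.card_union_le _ _).trans (add_le_add ?_ ?_))
      ((Finset.card_union_le _ _).trans (add_le_add ?_ ?_)))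
  · refine (Finset.card_image₂_le _ _ _).trans ?_
    rw [Finset.card_powerset, Finset.card_univ, Fintype.card_fin]
    gcongr
    · norm_num
    · simpa using card_filter_val_mem_Ico_le (n := m + 2 * r) m (m + r)
  · refine (Finset.card_image₂_le _ _ _).trans ?_
    rw [Finset.card_powerset, Finset.card_univ, Fintype.card_fin]
    gcongr
    · norm_num
    · have := card_filter_val_mem_Ico_le (n := m + 2 * r) (m + r) (m + 2 * r)
      simp only [Fin.is_lt, and_true] at this
      omega
  · refine (Finset.card_image₂_le _ _ _).trans ?_
    rw [Finset.card_univ, Fintype.card_fin]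
  · refine Finset.card_image_le.trans ?_
    rw [Finset.card_univ, Fintype.card_fin]

theorem two_mul_sum_powerset_card_sdiff {α : Type*} [DecidableEq α] (Q : Finset α) :
    2 * ∑ X ∈ Q.powerset, ((Q \ X).card : ℝ) = Q.card * 2 ^ Q.card := by
  have h1 : ∑ X ∈ Q.powerset, ((Q \ X).card : ℝ) = ∑ X ∈ Q.powerset, (X.card : ℝ) := by
    refine Finset.sum_nbij' (Q \ ·) (Q \ ·) ?_ ?_ ?_ ?_ ?_
    · simp
    · simp
    · exact fun X hX => Finset.sdiff_sdiff_eq_self (Finset.mem_powerset.1 hX)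
    · exact fun X hX => Finset.sdiff_sdiff_eq_self (Finset.mem_powerset.1 hX)
    · simp
  have h2 : ∑ X ∈ Q.powerset, ((Q \ X).card : ℝ) + ∑ X ∈ Q.powerset, (X.card : ℝ) =
      ∑ X ∈ Q.powerset, (Q.card : ℝ) := by
    rw [← Finset.sum_add_distrib]
    refine Finset.sum_congr rfl fun X hX => ?_
    exact_mod_cast Finset.card_sdiff_add_card_eq_card (Finset.mem_powerset.1 hX)
  rw [Finset.sum_const, Finset.card_powerset, nsmul_eq_mul] at h2
  push_cast at h2
  linarith

/-- The `4 ^ r` subtrees containing the path choose among `2 * r` leaves freely and lose `r` on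
average. Each of the others loses at most `n`, and there are at most `2 * 2 ^ r * n + n ^ 2 + n` of
them, so `n ^ 2 ≤ 2 ^ r` bounds their total loss by `4 * 4 ^ r`. -/
theorem card_sub_meanSubtreeOrder_doubleBroom_le (hm : 0 < m)
    (hr : (m + 2 * r) ^ 2 ≤ 2 ^ r) :
    ((m + 2 * r : ℕ) : ℝ) - (doubleBroom m r).meanSubtreeOrder ≤ r + 4 := by
  classical
  have hT := isTree_doubleBroom (r := r) hm
  set n := m + 2 * r with hn
  have hn1 : 1 ≤ n := by omega
  set C := (doubleBroom m r).subtreeSets with hC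
  set P := Finset.univ.filter (fun z : Fin n => z.1 < m) with hP
  have hPc : Pᶜ.card = 2 * r := by
    rw [Finset.card_compl, Fintype.card_fin, hP, Fin.card_filter_val_lt]
    omega
  have hfull : C.filter (P ⊆ ·) = Pᶜ.powerset.image (P ∪ ·) := by
    ext S
    simp only [Finset.mem_filter, Finset.mem_image, Finset.mem_powerset, hC, mem_subtreeSets]
    constructor
    · rintro ⟨-, h⟩
      refine ⟨S \ P, fun z hz => Finset.mem_compl.2 (Finset.mem_sdiff.1 hz).2, ?_⟩
      exact Finset.union_sdiff_of_subset h
    · rintro ⟨X, -, rfl⟩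
      refine ⟨connectedOn_parentGraph (doubleBroom_parent_lt hm) ?_ fun i _ h => ?_,
        Finset.subset_union_left⟩
      · exact Finset.mem_union_left _ (by simpa [hP] using hm)
      · refine Finset.mem_union_left _ ?_
        simp only [hP, Finset.mem_filter, Finset.mem_univ, true_and]
        rw [doubleBroom_parent_val hm]
        unfold broomParent
        split_ifs <;> omega
  have hinj : Set.InjOn (P ∪ ·) (Pᶜ.powerset : Set (Finset (Fin n))) := by
    intro X hX Y hY h
    simp only [Finset.coe_powerset, Set.mem_preimage, Set.mem_powerset_iff,
      Finset.coe_subset] at hX hY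
    ext z
    have h1 := Finset.ext_iff.1 h z
    have h2 := @hX z
    have h3 := @hY z
    simp only [Finset.mem_union, Finset.mem_compl] at h1 h2 h3
    tauto
  have hfc : (C.filter (P ⊆ ·)).card = 2 ^ (2 * r) := by
    rw [hfull, Finset.card_image_of_injOn hinj, Finset.card_powerset, hPc]
  have hfl : totalLoss (C.filter (P ⊆ ·)) = r * 2 ^ (2 * r) := by
    have h1 : totalLoss (C.filter (P ⊆ ·)) = ∑ X ∈ Pᶜ.powerset, ((Pᶜ \ X).card : ℝ) := by
      rw [hfull, totalLoss, Finset.sum_image hinj]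
      refine Finset.sum_congr rfl fun X _ => ?_
      congr 2
      ext z
      simp
    have h2 := two_mul_sum_powerset_card_sdiff Pᶜ
    rw [← h1, hPc] at h2
    push_cast at h2
    linarith
  have hrest : ((C.filter (¬ P ⊆ ·)).card : ℝ) ≤ (2 ^ r * n + 2 ^ r * n) + (n * n + n) := by
    exact_mod_cast card_filter_not_path_subset_le (r := r) hm
  have hrl : totalLoss (C.filter (¬ P ⊆ ·)) ≤ (C.filter (¬ P ⊆ ·)).card * n := by
    rw [totalLoss, ← nsmul_eq_mul]
    refine Finset.sum_le_card_nsmul _ _ _ fun S _ => ?_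
    have := Finset.card_le_univ Sᶜ
    rw [Fintype.card_fin] at this
    exact_mod_cast this
  have hsum : totalLoss C = totalLoss (C.filter (P ⊆ ·)) + totalLoss (C.filter (¬ P ⊆ ·)) :=
    (Finset.sum_filter_add_sum_filter_not C (P ⊆ ·) _).symm
  have hcard : (2 : ℝ) ^ (2 * r) ≤ C.card := by
    have := Finset.card_le_card (Finset.filter_subset (P ⊆ ·) C)
    rw [hfc] at this
    exact_mod_cast this
  have hloss := hT.totalLoss_eq
  rw [← hC, Fintype.card_fin, hsum, hfl] at hloss
  have hn1' : (1 : ℝ) ≤ n := by exact_mod_cast hn1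
  have hr' : (n : ℝ) ^ 2 ≤ 2 ^ r := by exact_mod_cast hr
  have hpow : (2 : ℝ) ^ (2 * r) = 2 ^ r * 2 ^ r := by rw [two_mul, pow_add]
  have h1 : (n : ℝ) ^ 2 * 2 ^ r ≤ 2 ^ (2 * r) := by
    rw [hpow]
    gcongr
  have h2 : (n : ℝ) ^ 2 * n ^ 2 ≤ n ^ 2 * 2 ^ r := by gcongr
  have h3 : (n : ℝ) ^ 3 ≤ n ^ 2 * n ^ 2 := by
    rw [← pow_add]
    exact pow_le_pow_right₀ hn1' (by norm_num)
  have h4 : (n : ℝ) ^ 2 ≤ n ^ 3 := pow_le_pow_right₀ hn1' (by norm_num)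
  have h5 : ((C.filter (¬ P ⊆ ·)).card : ℝ) * n ≤
      ((2 ^ r * n + 2 ^ r * n) + (n * n + n)) * n := by gcongr
  have h6 : (0 : ℝ) < C.card := by exact_mod_cast hT.card_subtreeSets_pos
  refine le_of_mul_le_mul_right (a := (C.card : ℝ)) ?_ h6
  rw [← hloss]
  calc (r : ℝ) * 2 ^ (2 * r) + totalLoss (C.filter (¬ P ⊆ ·))
      ≤ (r + 4) * 2 ^ (2 * r) := by linarith
    _ ≤ (r + 4) * C.card := by gcongr

end DoubleBroom
end SimpleGraph

/-! ### Optimal trees and the asymptotic estimate. -/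

namespace SimpleGraph

theorem IsOptimalTree.sub_meanSubtreeOrder_le {n r : ℕ} {G : SimpleGraph (Fin n)}
    (hG : G.IsOptimalTree) (h : 2 * r < n) (hr : n ^ 2 ≤ 2 ^ r) :
    (n : ℝ) - G.meanSubtreeOrder ≤ r + 4 := by
  obtain ⟨m, rfl⟩ : ∃ m, n = m + 2 * r := ⟨n - 2 * r, by omega⟩
  have hm : 0 < m := by omega
  have : NeZero (m + 2 * r) := ⟨by omega⟩
  have h1 := card_sub_meanSubtreeOrder_doubleBroom_le hm hr
  have h2 := hG.2 _ (isTree_doubleBroom (r := r) hm)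
  linarith

/-- Comparison with the broom for `r = ⌈2 * logb 2 n⌉₊`, the least `r` with `n ^ 2 ≤ 2 ^ r`; the
ceiling raises the constant from `4` to `5`. -/
theorem IsOptimalTree.sub_meanSubtreeOrder_le_logb {n : ℕ} {G : SimpleGraph (Fin n)}
    (hG : G.IsOptimalTree) (hn : 4 * Real.logb 2 n + 2 < n) :
    (n : ℝ) - G.meanSubtreeOrder ≤ 2 * Real.logb 2 n + 5 := by
  have hn0 : n ≠ 0 := by
    rintro rfl
    norm_num at hn
  have hpos : (0 : ℝ) < n := by exact_mod_cast Nat.pos_of_ne_zero hn0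
  have hx : 0 ≤ Real.logb 2 n :=
    Real.logb_nonneg one_lt_two (by exact_mod_cast Nat.one_le_iff_ne_zero.2 hn0)
  have h1 := Nat.ceil_lt_add_one (mul_nonneg zero_le_two hx)
  have h2 : 2 * ⌈2 * Real.logb 2 n⌉₊ < n := by
    have : (2 : ℝ) * ⌈2 * Real.logb 2 n⌉₊ < n := by linarith
    exact_mod_cast this
  have h3 : n ^ 2 ≤ 2 ^ ⌈2 * Real.logb 2 n⌉₊ := by
    have : (n : ℝ) ^ 2 ≤ 2 ^ ⌈2 * Real.logb 2 n⌉₊ := by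
      rw [← Real.rpow_natCast 2, ← Real.logb_le_iff_le_rpow one_lt_two (by positivity),
        Real.logb_pow]
      exact_mod_cast Nat.le_ceil _
    exact_mod_cast this
  have := hG.sub_meanSubtreeOrder_le h2 h3
  linarith

theorem IsTree.diam_lt_card {V : Type*} [Fintype V] {G : SimpleGraph V} (hG : G.IsTree) :
    G.diam < Fintype.card V := by
  have := hG.connected.nonempty
  obtain ⟨p, q, hpq⟩ := G.exists_dist_eq_diam
  obtain ⟨P, hP, hPl⟩ := hG.connected.exists_path_of_dist p q
  rw [← hpq, ← hPl]
  exact hP.length_lt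

theorem eventually_mul_logb_pow_le_rpow {ε : ℝ} (hε : 0 < ε) :
    ∀ᶠ n : ℕ in atTop, 12288 * (2 * Real.logb 2 n + 5) ^ 6 ≤ (n : ℝ) ^ ε := by
  set K : ℝ := 2 * (1 / (ε / 12) / Real.log 2) + 5
  have hlog : 0 < Real.log 2 := Real.log_pos one_lt_two
  have hK : 0 < K := by positivity
  have h1 : ∀ᶠ n : ℕ in atTop, 12288 * K ^ 6 ≤ (n : ℝ) ^ (ε / 2) :=
    ((tendsto_rpow_atTop (half_pos hε)).comp tendsto_natCast_atTop_atTop).eventually_ge_atTop _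
  filter_upwards [h1, eventually_ge_atTop 1] with n hn hn1
  have hn1' : (1 : ℝ) ≤ n := by exact_mod_cast hn1
  have h2 : (1 : ℝ) ≤ (n : ℝ) ^ (ε / 12) := Real.one_le_rpow hn1' (by positivity)
  have h3 : 2 * Real.logb 2 n + 5 ≤ K * (n : ℝ) ^ (ε / 12) := by
    have h4 : Real.logb 2 n ≤ 1 / (ε / 12) / Real.log 2 * (n : ℝ) ^ (ε / 12) := by
      have := Real.log_le_rpow_div (x := n) (by positivity) (show 0 < ε / 12 by positivity)
      rw [Real.logb, div_le_iff₀ hlog]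
      refine this.trans (le_of_eq ?_)
      field_simp
    simp only [K]
    linarith
  have h5 : 0 ≤ 2 * Real.logb 2 n + 5 := by
    have := Real.logb_nonneg one_lt_two hn1'
    linarith
  calc 12288 * (2 * Real.logb 2 n + 5) ^ 6 ≤ 12288 * (K * (n : ℝ) ^ (ε / 12)) ^ 6 := by gcongr
    _ = (12288 * K ^ 6) * (n : ℝ) ^ (ε / 2) := by
      rw [mul_pow, ← Real.rpow_mul_natCast (by positivity),
        show ε / 12 * (6 : ℕ) = ε / 2 by push_cast; ring]
      ring
    _ ≤ (n : ℝ) ^ (ε / 2) * (n : ℝ) ^ (ε / 2) := by gcongr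
    _ = (n : ℝ) ^ ε := by
      rw [← Real.rpow_add (by positivity)]
      congr 1
      ring

/-- If the bound failed, the count of subtrees through `v` would exceed `n ^ (4 + 2 * ε)`, whereas
its logarithm is at most `2 * B + 1 = 4 * logb 2 n + 11`. The hypothesis `h2` makes `2 * ε * logb 2
n` larger than `12`. -/
theorem IsOptimalTree.sub_diam_le {n : ℕ} {G : SimpleGraph (Fin n)} (hG : G.IsOptimalTree)
    {ε : ℝ} (hn : 2 ≤ n)
    (h1 : 12288 * (2 * Real.logb 2 n + 5) ^ 6 ≤ (n : ℝ) ^ ε) (h2 : 6 < ε * Real.logb 2 n) :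
    (n : ℝ) - G.diam ≤ (n : ℝ) ^ (1 / 2 + ε) + 1 := by
  by_contra! hcon
  have hn2 : (2 : ℝ) ≤ n := by exact_mod_cast hn
  have hn0 : (0 : ℝ) < n := by linarith
  have hx : 0 ≤ Real.logb 2 n := Real.logb_nonneg one_lt_two (by linarith)
  set x := Real.logb 2 n with hxdef
  set B := 2 * x + 5 with hB
  set s := (n : ℝ) ^ (1 / 2 + ε) with hs
  have hB5 : 5 ≤ B := by linarith
  have hB1 : 1 ≤ B := by linarith
  have hBs : 12288 * B ^ 6 ≤ s := h1.trans
    (Real.rpow_le_rpow_of_exponent_le (by linarith) (by linarith))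
  have hB16 : B ≤ B ^ 6 := le_self_pow₀ hB1 (by norm_num)
  have hB36 : B ^ 3 ≤ B ^ 6 := pow_le_pow_right₀ hB1 (by norm_num)
  have hB23 : B ^ 2 ≤ B ^ 3 := pow_le_pow_right₀ hB1 (by norm_num)
  have hspos : 0 < s := by positivity
  have hd0 : (0 : ℝ) ≤ G.diam := Nat.cast_nonneg _
  have hL : (n : ℝ) - G.meanSubtreeOrder ≤ B :=
    hG.sub_meanSubtreeOrder_le_logb (by rw [← hxdef]; linarith)
  have hd : G.diam + 1 < Fintype.card (Fin n) := by
    rw [Fintype.card_fin]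
    have : (G.diam : ℝ) + 1 < n := by linarith
    exact_mod_cast this
  have hk := hG.1.card_leafSet_le (by rwa [Fintype.card_fin])
  obtain ⟨v, y₁, y₂, y₃, w₁, w₂, w₃, p₁, p₂, p₃, hpos, h31, h32, n12, n13, n23, hdiam, hcard⟩ :=
    hG.1.exists_three_paths hd
  have key := hG.1.logb_le_mul_of_three_paths p₁ p₂ p₃ hpos h31 h32 n12 n13 n23 (B := B)
  rw [Fintype.card_fin] at hk hcard key
  have hca : (w₃.length : ℝ) ≤ w₁.length := by exact_mod_cast h31
  have hcb : (w₃.length : ℝ) ≤ w₂.length := by exact_mod_cast h32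
  have hc0 : (0 : ℝ) < w₃.length := by exact_mod_cast hpos
  have hdiam' : (w₁.length : ℝ) + w₂.length = G.diam := by exact_mod_cast hdiam
  have hcard' : (n : ℝ) ≤ G.diam + 1 + G.leafSet.card * w₃.length := by exact_mod_cast hcard
  generalize (w₁.length : ℝ) = a at *
  generalize (w₂.length : ℝ) = b at *
  generalize (w₃.length : ℝ) = c at *
  generalize (G.diam : ℝ) = d at *
  have hkc : (G.leafSet.card : ℝ) * c ≤ 4 * B * c := by
    gcongr
    linarith
  have hsc : s ≤ 4 * B * c := by linarith
  have hBc3 : B * (2 * B + 1) < c := by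
    by_contra! h
    have : 4 * B * c ≤ 4 * B * (B * (2 * B + 1)) := by gcongr
    have e : 4 * B * (B * (2 * B + 1)) = 8 * B ^ 3 + 4 * B ^ 2 := by ring
    linarith
  have hBB : 5 * B ≤ B * B := by gcongr
  have key := key hL (by linarith)
  -- As `c` exceeds `B * (2 * B + 1)`, dropping the factor `1 - B / c` costs at most `1`.
  have hY : Real.logb 2 ((a * b * c) ^ 2 / (16 * B) ^ 3) ≤ 2 * B + 1 := by
    by_contra! h
    have hu : B / c * (2 * B + 1) < 1 := by
      rw [div_mul_eq_mul_div, div_lt_one hc0]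
      exact hBc3
    have hu' : B / c ≤ 1 := by
      rw [div_le_one hc0]
      linarith
    have := mul_le_mul_of_nonneg_left h.le (sub_nonneg.2 hu')
    linarith
  -- From `n ≤ d + 1 + 4 * B * c` and `2 * c ≤ a + b = d`.
  have hdn : (n : ℝ) ≤ 6 * B * d := by
    have e1 : B * (2 * c) ≤ B * d := by
      gcongr
      linarith
    have e2 : 1 * d ≤ B * d := by gcongr
    linarith
  have hab : c * d ≤ 2 * (a * b) := by
    have e1 := mul_nonneg (sub_nonneg.2 hca) (hc0.le.trans hcb)
    have e2 := mul_nonneg (sub_nonneg.2 hcb) (hc0.le.trans hca)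
    rw [← hdiam']
    linarith
  have habc : s ^ 2 * n ≤ 192 * B ^ 3 * (a * b * c) := by
    calc s ^ 2 * n ≤ (4 * B * c) ^ 2 * (6 * B * d) := by gcongr
      _ = 96 * B ^ 3 * c * (c * d) := by ring
      _ ≤ 96 * B ^ 3 * c * (2 * (a * b)) := by gcongr
      _ = 192 * B ^ 3 * (a * b * c) := by ring
  -- The constant of `h1` satisfies `12288 ^ 2 = 16 ^ 3 * 192 ^ 2`, so the factor `n ^ (2 * ε)`
  -- absorbs all powers of `B`.
  have hlow : (n : ℝ) ^ (4 + 2 * ε) ≤ (a * b * c) ^ 2 / (16 * B) ^ 3 := by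
    rw [le_div_iff₀ (by positivity)]
    have e1 : (n : ℝ) ^ (4 + 2 * ε) * (n : ℝ) ^ (2 * ε) = (s ^ 2 * n) ^ 2 := by
      rw [hs, mul_pow, ← pow_mul, ← Real.rpow_mul_natCast hn0.le, ← Real.rpow_natCast (n : ℝ) 2,
        ← Real.rpow_add hn0, ← Real.rpow_add hn0]
      congr 1
      push_cast
      ring
    have e2 : (12288 * B ^ 6) ^ 2 ≤ (n : ℝ) ^ (2 * ε) := by
      rw [mul_comm 2 ε, Real.rpow_mul hn0.le, Real.rpow_two]
      gcongr
    have e3 : (n : ℝ) ^ (4 + 2 * ε) * (12288 * B ^ 6) ^ 2 ≤ (192 * B ^ 3 * (a * b * c)) ^ 2 :=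
      calc (n : ℝ) ^ (4 + 2 * ε) * (12288 * B ^ 6) ^ 2
          ≤ (n : ℝ) ^ (4 + 2 * ε) * (n : ℝ) ^ (2 * ε) := by gcongr
        _ = (s ^ 2 * n) ^ 2 := e1
        _ ≤ _ := by gcongr
    have e4 : B ^ 3 * B ^ 6 ≤ B ^ 6 * B ^ 6 := by gcongr
    have e5 : (n : ℝ) ^ (4 + 2 * ε) * (16 * B) ^ 3 * (192 * B ^ 3) ^ 2 ≤
        (a * b * c) ^ 2 * (192 * B ^ 3) ^ 2 :=
      calc (n : ℝ) ^ (4 + 2 * ε) * (16 * B) ^ 3 * (192 * B ^ 3) ^ 2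
          = (n : ℝ) ^ (4 + 2 * ε) * (150994944 * (B ^ 3 * B ^ 6)) := by ring
        _ ≤ (n : ℝ) ^ (4 + 2 * ε) * (150994944 * (B ^ 6 * B ^ 6)) := by gcongr
        _ = (n : ℝ) ^ (4 + 2 * ε) * (12288 * B ^ 6) ^ 2 := by ring
        _ ≤ (192 * B ^ 3 * (a * b * c)) ^ 2 := e3
        _ = _ := by ring
    exact le_of_mul_le_mul_right e5 (by positivity)
  have hY' := Real.logb_le_logb_of_le one_lt_two (by positivity) hlow
  rw [Real.logb_rpow_eq_mul_logb_of_pos hn0, ← hxdef] at hY'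
  linarith

end SimpleGraph

theorem mainTheorem7 (T : (n : ℕ) → SimpleGraph (Fin n))
    (hT : ∀ n : ℕ, 1 ≤ n → (T n).IsOptimalTree) (δ : ℝ) (hδ : 0 < δ) :
    Tendsto (fun n : ℕ => ((n : ℝ) - ((T n).diam : ℝ)) / (n : ℝ) ^ (1 / 2 + δ))
      atTop (𝓝 0) := by
  -- The estimate is used with `ε = δ / 2`; the other half of `δ` sends the quotient to `0`.
  have hδ2 := half_pos hδ
  have hlim : Tendsto (fun n : ℕ => 2 * (n : ℝ) ^ (-(δ / 2))) atTop (𝓝 0) := by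
    simpa using ((tendsto_rpow_neg_atTop hδ2).comp tendsto_natCast_atTop_atTop).const_mul 2
  have hlog : ∀ᶠ n : ℕ in atTop, 6 < δ / 2 * Real.logb 2 n :=
    (((Real.tendsto_logb_atTop one_lt_two).comp tendsto_natCast_atTop_atTop).const_mul_atTop
      hδ2).eventually_gt_atTop 6
  refine squeeze_zero' ?_ ?_ hlim
  · filter_upwards [eventually_ge_atTop 1] with n hn
    have h := (hT n hn).1.diam_lt_card
    rw [Fintype.card_fin] at h
    have : ((T n).diam : ℝ) ≤ n := by exact_mod_cast h.le
    exact div_nonneg (by linarith) (by positivity)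
  · filter_upwards [eventually_ge_atTop 2, hlog, SimpleGraph.eventually_mul_logb_pow_le_rpow hδ2]
      with n hn h6 hp
    have hn1 : (1 : ℝ) ≤ n := by exact_mod_cast (by omega : 1 ≤ n)
    have h := (hT n (by omega)).sub_diam_le hn hp h6
    have h1 : (1 : ℝ) ≤ (n : ℝ) ^ (1 / 2 + δ / 2) := Real.one_le_rpow hn1 (by positivity)
    rw [div_le_iff₀ (by positivity), mul_assoc, ← Real.rpow_add (by linarith),
      show -(δ / 2) + (1 / 2 + δ) = 1 / 2 + δ / 2 by ring]
    linarith
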